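/- Fix a relational signature with countably many relation symbols of every arity $n\ge 0$ (no constants, no function symbols), and consider first-order formulas without equality over it, written in negation normal form (negation only in front of atoms; the only other Boolean connectives are $\wedge$ and $\vee$). The formulas of $\mathrm{AUF}_1^-$ form the smallest set $\mathcal F$ such that: - every atom that uses at most one variable, and the negation of every such atom, is in $\mathcal F$; - $\mathcal F$ is closed under $\wedge$ and $\vee$; - if $k\ge 0$, $x_0,\dots,x_k$ are distinct variables, and $\varphi$ is a combination, by $\wedge$ and $\vee$, of formulas in $\mathcal F$ whose free variables are among $x_0,\dots,x_k$ and of atoms and negated atoms whose set of variables is precisely $\{x_0,\dots,x_k\}$ (in any order, possibly with repetitions), then $Q_0x_0\dots Q_kx_k\,\varphi$ and $Q_1x_1\dots Q_kx_k\,\varphi$ are in $\mathcal F$ for all quantifiers $Q_i\in\{\exists,\forall\}$ such that the quantifiers of the block are either all universal or the last one, $Q_k$, is existential. Theorem. The satisfiability problem for $\mathrm{AUF}_1^-$ is decidable: there is an algorithm which, given a formula, decides whether it is a sentence of $\mathrm{AUF}_1^-$ that has a model, where models are structures with a non-empty, finite or infinite, domain. That is, the set of satisfiable sentences of $\mathrm{AUF}_1^-$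 is computable. -/

import Mathlib

universe u

namespace AUF

/-- The relational signature with countably many relation symbols `0, 1, 2, …` of every arity
`n ≥ 0`, no constants, no function symbols. Every formula over a finite (or countable) relational
signature is, up to naming of its symbols, a formula over this one. -/
def sig : FirstOrder.Language.{0, 0} where
  Functions := fun _ => Empty
  Relations := fun _ => ℕ

/-- Equality-free first-order formulas over `sig` in negation normal form, with variables named by
natural numbers. `atom R [x₁, …, xₙ]` is the atom `R(x₁, …, xₙ)`, where `R` is the `R`-th relation
symbol of arity `n`, and `natom R [x₁, …, xₙ]` is its negation. -/
inductive Formula : Type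
  | atom (R : ℕ) (args : List ℕ) : Formula
  | natom (R : ℕ) (args : List ℕ) : Formula
  | and (φ ψ : Formula) : Formula
  | or (φ ψ : Formula) : Formula
  | all (x : ℕ) (φ : Formula) : Formula
  | ex (x : ℕ) (φ : Formula) : Formula

namespace Formula

/-- The set of free variables. -/
def fv : Formula → Finset ℕ
  | atom _ args => args.toFinset
  | natom _ args => args.toFinset
  | and φ ψ => φ.fv ∪ ψ.fv
  | or φ ψ => φ.fv ∪ ψ.fv
  | all x φ => φ.fv.erase x
  | ex x φ => φ.fv.erase x

/-- Satisfaction of a formula in a structure under an assignment `v`. -/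
def Realize {A : Type u} [sig.Structure A] : Formula → (ℕ → A) → Prop
  | atom R args, v =>
      FirstOrder.Language.Structure.RelMap (L := sig) (n := args.length) R
        (fun i => v (args.get i))
  | natom R args, v =>
      ¬ FirstOrder.Language.Structure.RelMap (L := sig) (n := args.length) R
        (fun i => v (args.get i))
  | and φ ψ, v => φ.Realize v ∧ ψ.Realize v
  | or φ ψ, v => φ.Realize v ∨ ψ.Realize v
  | all x φ, v => ∀ a : A, φ.Realize (Function.update v x a)
  | ex x φ, v => ∃ a : A, φ.Realize (Function.update v x a)

/-- A sentence is a formula without free variables. -/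
def IsSentence (φ : Formula) : Prop := φ.fv = ∅

/-- `φ` has a model: a structure with a non-empty domain, finite or infinite, in which `φ` is true
(for a sentence the assignment is immaterial). -/
def Satisfiable (φ : Formula) : Prop :=
  ∃ (A : Type u) (_ : Nonempty A) (_ : sig.Structure A), ∀ v : ℕ → A, φ.Realize v

/-! ### Formulas as inputs of algorithms: an effective bijective numbering -/

/-- The Gödel number of a formula. -/
def toNat : Formula → ℕ
  | atom R args => 6 * Nat.pair R (Encodable.encode args)
  | natom R args => 6 * Nat.pair R (Encodable.encode args) + 1
  | and φ ψ => 6 * Nat.pair φ.toNat ψ.toNat + 2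
  | or φ ψ => 6 * Nat.pair φ.toNat ψ.toNat + 3
  | all x φ => 6 * Nat.pair x φ.toNat + 4
  | ex x φ => 6 * Nat.pair x φ.toNat + 5

/-- The formula with a given Gödel number. -/
def ofNat (n : ℕ) : Formula :=
  if h0 : n % 6 = 0 then atom (n / 6).unpair.1 (Denumerable.ofNat (List ℕ) (n / 6).unpair.2)
  else if h1 : n % 6 = 1 then
    natom (n / 6).unpair.1 (Denumerable.ofNat (List ℕ) (n / 6).unpair.2)
  else
    have hn : n / 6 < n := by omega
    have hl : (n / 6).unpair.1 < n := lt_of_le_of_lt (Nat.unpair_left_le _) hn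
    have hr : (n / 6).unpair.2 < n := lt_of_le_of_lt (Nat.unpair_right_le _) hn
    if n % 6 = 2 then and (ofNat (n / 6).unpair.1) (ofNat (n / 6).unpair.2)
    else if n % 6 = 3 then or (ofNat (n / 6).unpair.1) (ofNat (n / 6).unpair.2)
    else if n % 6 = 4 then all (n / 6).unpair.1 (ofNat (n / 6).unpair.2)
    else ex (n / 6).unpair.1 (ofNat (n / 6).unpair.2)
termination_by n

theorem ofNat_toNat (φ : Formula) : ofNat φ.toNat = φ := by
  induction φ with
  | atom R args =>
    rw [toNat, ofNat, dif_pos (by omega)]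
    simp
  | natom R args =>
    have hd : (6 * Nat.pair R (Encodable.encode args) + 1) / 6
        = Nat.pair R (Encodable.encode args) := by omega
    rw [toNat, ofNat, dif_neg (by omega), dif_pos (by omega), hd]
    simp
  | and φ ψ hφ hψ =>
    have hd : (6 * Nat.pair φ.toNat ψ.toNat + 2) / 6 = Nat.pair φ.toNat ψ.toNat := by omega
    rw [toNat, ofNat, dif_neg (by omega), dif_neg (by omega), if_pos (by omega), hd]
    simp [hφ, hψ]
  | or φ ψ hφ hψ =>
    have hd : (6 * Nat.pair φ.toNat ψ.toNat + 3) / 6 = Nat.pair φ.toNat ψ.toNat := by omega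
    rw [toNat, ofNat, dif_neg (by omega), dif_neg (by omega), if_neg (by omega),
      if_pos (by omega), hd]
    simp [hφ, hψ]
  | all x φ hφ =>
    have hd : (6 * Nat.pair x φ.toNat + 4) / 6 = Nat.pair x φ.toNat := by omega
    rw [toNat, ofNat, dif_neg (by omega), dif_neg (by omega), if_neg (by omega),
      if_neg (by omega), if_pos (by omega), hd]
    simp [hφ]
  | ex x φ hφ =>
    have hd : (6 * Nat.pair x φ.toNat + 5) / 6 = Nat.pair x φ.toNat := by omega
    rw [toNat, ofNat, dif_neg (by omega), dif_neg (by omega), if_neg (by omega),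
      if_neg (by omega), if_neg (by omega), hd]
    simp [hφ]

theorem toNat_ofNat (n : ℕ) : (ofNat n).toNat = n := by
  induction n using Nat.strong_induction_on with
  | _ n ih =>
    have key : n % 6 ≠ 0 → n / 6 < n := fun h => by omega
    have hl : n % 6 ≠ 0 → (n / 6).unpair.1 < n := fun h =>
      lt_of_le_of_lt (Nat.unpair_left_le _) (key h)
    have hr : n % 6 ≠ 0 → (n / 6).unpair.2 < n := fun h =>
      lt_of_le_of_lt (Nat.unpair_right_le _) (key h)
    rw [ofNat]
    split_ifs with h0 h1 h2 h3 h4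
    · simp only [toNat, Denumerable.encode_ofNat, Nat.pair_unpair]
      omega
    · simp only [toNat, Denumerable.encode_ofNat, Nat.pair_unpair]
      omega
    · simp only [toNat, ih _ (hl h0), ih _ (hr h0), Nat.pair_unpair]
      omega
    · simp only [toNat, ih _ (hl h0), ih _ (hr h0), Nat.pair_unpair]
      omega
    · simp only [toNat, ih _ (hr h0), Nat.pair_unpair]
      omega
    · simp only [toNat, ih _ (hr h0), Nat.pair_unpair]
      omega

/-- The numbering as a bijection. It is what makes `Formula` an input type for computable
functions (`Primcodable`). -/
instance : Denumerable Formula :=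
  Denumerable.mk' ⟨toNat, ofNat, ofNat_toNat, toNat_ofNat⟩

end Formula

/-- The two quantifiers. -/
inductive Quantifier : Type
  | all : Quantifier
  | ex : Quantifier

/-- `quantify [(Q₁, x₁), …, (Qₖ, xₖ)] φ` is the formula `Q₁ x₁ … Qₖ xₖ φ`. -/
def quantify : List (Quantifier × ℕ) → Formula → Formula
  | [], φ => φ
  | (Quantifier.all, x) :: b, φ => Formula.all x (quantify b φ)
  | (Quantifier.ex, x) :: b, φ => Formula.ex x (quantify b φ)

/-- The sequences of quantifiers that are allowed in a block: the purely universal ones and those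
whose last quantifier is existential. -/
def Admissible (Q : List Quantifier) : Prop :=
  (∀ q ∈ Q, q = Quantifier.all) ∨ Q.getLast? = some Quantifier.ex

mutual

/-- The formulas of the logic `AUF₁⁻`. -/
inductive IsAUFm : Formula → Prop
  | atom (R : ℕ) (args : List ℕ) (h : args.toFinset.card ≤ 1) : IsAUFm (Formula.atom R args)
  | natom (R : ℕ) (args : List ℕ) (h : args.toFinset.card ≤ 1) : IsAUFm (Formula.natom R args)
  | and {φ ψ : Formula} (hφ : IsAUFm φ) (hψ : IsAUFm ψ) : IsAUFm (Formula.and φ ψ)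
  | or {φ ψ : Formula} (hφ : IsAUFm φ) (hψ : IsAUFm ψ) : IsAUFm (Formula.or φ ψ)
  /-- `Q₀ x₀ … Qₖ xₖ φ` for `φ` a combination over the set `{x₀, …, xₖ}` of distinct variables -/
  | block (b : List (Quantifier × ℕ)) (φ : Formula) (hne : b ≠ [])
      (hx : (b.map Prod.snd).Nodup) (hQ : Admissible (b.map Prod.fst))
      (hφ : IsComb (b.map Prod.snd).toFinset φ) : IsAUFm (quantify b φ)
  /-- `Q₁ x₁ … Qₖ xₖ φ` for `φ` a combination over the set `{x₀, …, xₖ}` of distinct variables -/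
  | blockFree (x₀ : ℕ) (b : List (Quantifier × ℕ)) (φ : Formula)
      (hx : (x₀ :: b.map Prod.snd).Nodup) (hQ : Admissible (b.map Prod.fst))
      (hφ : IsComb (x₀ :: b.map Prod.snd).toFinset φ) : IsAUFm (quantify b φ)

/-- `IsComb V φ`: the formula `φ` is a Boolean combination (in negation normal form) of formulas of
`AUF₁⁻` with free variables in `V` and of atoms whose set of variables is precisely `V`. -/
inductive IsComb : Finset ℕ → Formula → Prop
  | mem {V : Finset ℕ} {φ : Formula} (hφ : IsAUFm φ) (hV : φ.fv ⊆ V) : IsComb V φ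
  | atom {V : Finset ℕ} (R : ℕ) (args : List ℕ) (h : args.toFinset = V) :
      IsComb V (Formula.atom R args)
  | natom {V : Finset ℕ} (R : ℕ) (args : List ℕ) (h : args.toFinset = V) :
      IsComb V (Formula.natom R args)
  | and {V : Finset ℕ} {φ ψ : Formula} (hφ : IsComb V φ) (hψ : IsComb V ψ) :
      IsComb V (Formula.and φ ψ)
  | or {V : Finset ℕ} {φ ψ : Formula} (hφ : IsComb V φ) (hψ : IsComb V ψ) :
      IsComb V (Formula.or φ ψ)

end

end AUF

/-! The logic has no equality, so a model may be replaced by one in which elements are copies of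
elements of the old model, and this allows for a small model property with an explicit bound. Let
`A` be a structure and `n` the code of a sentence. The finite model consists of the points
`Point A n`; each point has the `n`-type of an element of `A` (`typ`, `Point.rep`). The atoms on a
tuple of points are copied from `A` along a type-preserving map `Point.loc S` that depends on the set
`S` of entries of the tuple only. In a block over `x₀, …, xₖ` all relevant atoms with more than one
variable use all of `x₀, …, xₖ`, so different sets of entries do not interfere.

Universal blocks then hold because each tuple of points looks like a tuple of elements of `A` of the
same types (`Point.realize_quantify_of_universal`). For a block that ends with an existential
quantifier, a play over the points is accompanied by a play over `A`, in which old points are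
answered by old elements. The last existential move has to choose the point `z` in such a way that
`Point.loc S`, for `S` the set of all points played, agrees with the play over `A`
(`Point.exists_of_similar`). For this purpose every point carries a table of demanded truth values,
and a set `S` obeys the table of its designated point, the one whose colour is the sum of the
residues of all points of `S`. A point with a colour that is new and with a suitable residue is
always designated (`Point.exists_designated`), so the demands of different tuples never conflict.
Together with an induction over the definition of the logic (`IsAUFm.realize_of_typ_eq`) this yields
`satisfiable_iff_exists_fin`: a satisfiable sentence has a model of size `modelSize n`.

The decision procedure is primitive recursive. Functions defined by recursion over formulas are
primitive recursive by course-of-values recursion over codes (`primrec_of_formula_rec`). Membership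
in the logic is recognized by such a recursion as well (`primrecPred_isAUFm`), on the basis of the
inversion lemma `isAUFm_iff_shape` and the list of all ways to split off a block of quantifiers
(`Formula.splits`). Models of the given size are searched for among all lists of facts
(`hasModelOfSize_iff`), where a formula is evaluated by computing the list of its satisfying
assignments. -/

namespace AUF
namespace Formula

/-! ### Codes, free variables and assignments -/

theorem lt_encode_of_mem {x : ℕ} : ∀ {l : List ℕ}, x ∈ l → x < Encodable.encode l
  | a :: l, h => by
    have h1 := Nat.left_le_pair a (Encodable.encode l)
    have h2 := Nat.right_le_pair a (Encodable.encode l)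
    rw [Encodable.encode_list_cons, Encodable.encode_nat]
    rcases List.mem_cons.1 h with rfl | h
    · omega
    · have := lt_encode_of_mem h
      omega

theorem length_le_encode : ∀ l : List ℕ, l.length ≤ Encodable.encode l
  | [] => by simp
  | a :: l => by
    have h2 := Nat.right_le_pair a (Encodable.encode l)
    have := length_le_encode l
    rw [Encodable.encode_list_cons, Encodable.encode_nat, List.length_cons]
    omega

theorem args_bounds (R : ℕ) (args : List ℕ) :
    R ≤ (atom R args).toNat ∧ args.length ≤ (atom R args).toNat ∧
      ∀ x ∈ args, x ≤ (atom R args).toNat := by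
  have h1 := Nat.left_le_pair R (Encodable.encode args)
  have h2 := Nat.right_le_pair R (Encodable.encode args)
  have h3 := length_le_encode args
  simp only [toNat]
  refine ⟨by omega, by omega, fun x hx => ?_⟩
  have := lt_encode_of_mem hx
  omega

theorem natom_toNat (R : ℕ) (args : List ℕ) :
    (natom R args).toNat = (atom R args).toNat + 1 := rfl

theorem and_bounds (φ ψ : Formula) :
    φ.toNat < (φ.and ψ).toNat ∧ ψ.toNat < (φ.and ψ).toNat := by
  have h1 := Nat.left_le_pair φ.toNat ψ.toNat
  have h2 := Nat.right_le_pair φ.toNat ψ.toNat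
  simp only [toNat]
  omega

theorem or_bounds (φ ψ : Formula) :
    φ.toNat < (φ.or ψ).toNat ∧ ψ.toNat < (φ.or ψ).toNat := by
  have h1 := Nat.left_le_pair φ.toNat ψ.toNat
  have h2 := Nat.right_le_pair φ.toNat ψ.toNat
  simp only [toNat]
  omega

theorem all_bounds (x : ℕ) (φ : Formula) :
    x < (all x φ).toNat ∧ φ.toNat < (all x φ).toNat := by
  have h1 := Nat.left_le_pair x φ.toNat
  have h2 := Nat.right_le_pair x φ.toNat
  simp only [toNat]
  omega

theorem ex_bounds (x : ℕ) (φ : Formula) :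
    x < (ex x φ).toNat ∧ φ.toNat < (ex x φ).toNat := by
  have h1 := Nat.left_le_pair x φ.toNat
  have h2 := Nat.right_le_pair x φ.toNat
  simp only [toNat]
  omega

theorem le_toNat_of_mem_fv {x : ℕ} {φ : Formula} (h : x ∈ φ.fv) : x ≤ φ.toNat := by
  induction φ with
  | atom R args => exact (args_bounds R args).2.2 x (by simpa [fv] using h)
  | natom R args =>
    have := (args_bounds R args).2.2 x (by simpa [fv] using h)
    rw [natom_toNat]
    omega
  | and φ ψ hφ hψ =>
    have := and_bounds φ ψ
    rcases Finset.mem_union.1 h with h | h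
    · have := hφ h
      omega
    · have := hψ h
      omega
  | or φ ψ hφ hψ =>
    have := or_bounds φ ψ
    rcases Finset.mem_union.1 h with h | h
    · have := hφ h
      omega
    · have := hψ h
      omega
  | all y φ hφ =>
    have := all_bounds y φ
    have := hφ (Finset.mem_of_mem_erase h)
    omega
  | ex y φ hφ =>
    have := ex_bounds y φ
    have := hφ (Finset.mem_of_mem_erase h)
    omega

section Semantics

variable {A : Type*} [sig.Structure A]

/-- The truth of an atom depends only on the list of values of its arguments. -/
theorem realize_atom_congr {R : ℕ} {l l' : List ℕ} {v w : ℕ → A} (h : l.map v = l'.map w) :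
    (atom R l).Realize v ↔ (atom R l').Realize w := by
  have key : (⟨l.length, fun i => v (l.get i)⟩ : Σ n, Fin n → A) =
      ⟨l'.length, fun i => w (l'.get i)⟩ := by
    rw [← List.ofFn_inj']
    simpa [List.map_ofFn, Function.comp_def] using h
  exact iff_of_eq (congrArg (fun p : Σ n, Fin n → A =>
    FirstOrder.Language.Structure.RelMap (L := sig) (n := p.1) R p.2) key)

theorem realize_congr {φ : Formula} {v w : ℕ → A} (h : ∀ x ∈ φ.fv, v x = w x) :
    φ.Realize v ↔ φ.Realize w := by
  induction φ generalizing v w with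
  | atom R args =>
    exact realize_atom_congr (List.map_congr_left fun x hx => h x (by simpa [fv] using hx))
  | natom R args =>
    exact not_congr (realize_atom_congr (R := R)
      (List.map_congr_left fun x hx => h x (by simpa [fv] using hx)))
  | and φ ψ hφ hψ =>
    exact and_congr (hφ fun x hx => h x (Finset.mem_union_left _ hx))
      (hψ fun x hx => h x (Finset.mem_union_right _ hx))
  | or φ ψ hφ hψ =>
    exact or_congr (hφ fun x hx => h x (Finset.mem_union_left _ hx))
      (hψ fun x hx => h x (Finset.mem_union_right _ hx))
  | all y φ hφ =>
    refine forall_congr' fun a => hφ fun x hx => ?_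
    by_cases hxy : x = y
    · subst hxy; simp
    · simpa [hxy] using h x (Finset.mem_erase.2 ⟨hxy, hx⟩)
  | ex y φ hφ =>
    refine exists_congr fun a => hφ fun x hx => ?_
    by_cases hxy : x = y
    · subst hxy; simp
    · simpa [hxy] using h x (Finset.mem_erase.2 ⟨hxy, hx⟩)

/-- Without equality, truth is invariant under surjective strong homomorphisms. -/
theorem realize_comp_of_surjective {B : Type*} [sig.Structure B] {f : A → B}
    (hf : Function.Surjective f)
    (hR : ∀ (R : ℕ) (l : List ℕ) (v : ℕ → A), (atom R l).Realize v ↔ (atom R l).Realize (f ∘ v))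
    (φ : Formula) (v : ℕ → A) : φ.Realize v ↔ φ.Realize (f ∘ v) := by
  induction φ generalizing v with
  | atom R args => exact hR R args v
  | natom R args => exact not_congr (hR R args v)
  | and φ ψ hφ hψ => exact and_congr (hφ v) (hψ v)
  | or φ ψ hφ hψ => exact or_congr (hφ v) (hψ v)
  | all y φ hφ =>
    simp only [Realize, hφ, Function.comp_update]
    exact (hf.forall (p := fun b => φ.Realize (Function.update (f ∘ v) y b))).symm
  | ex y φ hφ =>
    simp only [Realize, hφ, Function.comp_update]
    exact (hf.exists (p := fun b => φ.Realize (Function.update (f ∘ v) y b))).symm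

/-! ### Types of elements -/

/-- The `n`-type of an element `a`: the truth values of all formulas with code at most `n` when all
variables are assigned to `a`. Only its values at formulas with at most one free variable are of
interest. -/
def typ (n : ℕ) (a : A) : Fin (n + 1) → Prop :=
  fun c => (ofNat c).Realize fun _ => a

theorem realize_iff_of_typ_eq {n : ℕ} {φ : Formula} (hφ : φ.toNat ≤ n) (hc : φ.fv.card ≤ 1)
    {v w : ℕ → A} (h : ∀ x ∈ φ.fv, typ n (v x) = typ n (w x)) : φ.Realize v ↔ φ.Realize w := by
  rcases φ.fv.eq_empty_or_nonempty with h0 | ⟨x, hx⟩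
  · exact realize_congr (by simp [h0])
  · have hu : ∀ y ∈ φ.fv, y = x := fun y hy => Finset.card_le_one.1 hc y hy x hx
    have key := congrFun (h x hx) ⟨φ.toNat, by omega⟩
    simp only [typ, ofNat_toNat, eq_iff_iff] at key
    rw [realize_congr (w := fun _ => v x) fun y hy => by rw [hu y hy], key,
      realize_congr (v := fun _ => w x) fun y hy => by rw [hu y hy]]

end Semantics

end Formula

/-! ### Blocks of quantifiers -/

/-- The set of variables of a block of quantifiers. -/
def blockVars (b : List (Quantifier × ℕ)) : Finset ℕ := (b.map Prod.snd).toFinset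

@[simp] theorem blockVars_nil : blockVars [] = ∅ := rfl

@[simp] theorem blockVars_cons (q : Quantifier × ℕ) (b : List (Quantifier × ℕ)) :
    blockVars (q :: b) = insert q.2 (blockVars b) := by
  simp [blockVars]

theorem fv_quantify (b : List (Quantifier × ℕ)) (χ : Formula) :
    (quantify b χ).fv = χ.fv \ blockVars b := by
  induction b with
  | nil => simp [quantify]
  | cons q b ih =>
    obtain ⟨q, x⟩ := q
    cases q <;>
    · simp only [quantify, Formula.fv, ih, blockVars_cons]
      ext y
      simp only [Finset.mem_erase, Finset.mem_sdiff, Finset.mem_insert]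
      tauto

theorem toNat_add_length_le (b : List (Quantifier × ℕ)) (χ : Formula) :
    χ.toNat + b.length ≤ (quantify b χ).toNat := by
  induction b with
  | nil => simp [quantify]
  | cons q b ih =>
    obtain ⟨q, x⟩ := q
    cases q
    · have := Formula.all_bounds x (quantify b χ)
      simp only [quantify, List.length_cons]
      omega
    · have := Formula.ex_bounds x (quantify b χ)
      simp only [quantify, List.length_cons]
      omega

section Universal

variable {A : Type*} [sig.Structure A]

theorem realize_quantify_universal_iff {b : List (Quantifier × ℕ)}
    (hb : ∀ q ∈ b.map Prod.fst, q = Quantifier.all) (χ : Formula) (v : ℕ → A) :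
    (quantify b χ).Realize v ↔
      ∀ w : ℕ → A, (∀ x ∉ blockVars b, w x = v x) → χ.Realize w := by
  induction b generalizing v with
  | nil =>
    refine ⟨fun h w hw => ?_, fun h => h v fun _ _ => rfl⟩
    rwa [show w = v from funext fun x => hw x (by simp)]
  | cons q b ih =>
    obtain ⟨q, x⟩ := q
    obtain rfl : q = Quantifier.all := hb q (by simp)
    have ih := ih fun q hq => hb q (by simp_all)
    simp only [quantify, Formula.Realize, ih]
    constructor
    · intro h w hw
      refine h (w x) w fun y hy => ?_
      by_cases hxy : y = x
      · subst hxy; simp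
      · simpa [hxy] using hw y (by simp [hxy, hy])
    · intro h a w hw
      refine h w fun y hy => ?_
      simp only [blockVars_cons, Finset.mem_insert, not_or] at hy
      simpa [hy.1] using hw y hy.2

end Universal

open Formula

/-! ### The finite universe of points -/

/-- The points of the finite model built from a structure `A`. A point carries a colour `block` and
a residue `res`, which together designate at most one point of a suitable finite set of points, an
`n`-type `type`, and a `table`: a list of the formulas that are to be true on a tuple of points, as a
function of the positions of the entries of the tuple in an enumeration of a finite set. The
parameter `A` only serves to attach a structure to the points. -/
structure Point (A : Type u) (n : ℕ) : Type where
  block : ZMod (n + 2)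
  res : ZMod (n + 2)
  type : Fin (n + 1) → Prop
  table : Fin (n + 1) → (Fin (n + 1) → Fin (n + 2)) → Prop

/-- The number of points. -/
def modelSize (n : ℕ) : ℕ :=
  (n + 2) * ((n + 2) * (2 ^ (n + 1) * (2 ^ (n + 2) ^ (n + 1)) ^ (n + 1)))

namespace Point

/-- A point is a quadruple. -/
def equivProd (A : Type u) (n : ℕ) : Point A n ≃ ZMod (n + 2) × ZMod (n + 2) ×
    (Fin (n + 1) → Prop) × (Fin (n + 1) → (Fin (n + 1) → Fin (n + 2)) → Prop) where
  toFun d := (d.block, d.res, d.type, d.table)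
  invFun p := ⟨p.1, p.2.1, p.2.2.1, p.2.2.2⟩
  left_inv _ := rfl
  right_inv _ := rfl

instance (A : Type u) (n : ℕ) : Finite (Point A n) := Finite.of_equiv _ (equivProd A n).symm

theorem card_eq (A : Type u) (n : ℕ) : Nat.card (Point A n) = modelSize n := by
  rw [Nat.card_congr (equivProd A n)]
  simp [modelSize]

open Classical in
/-- An enumeration of a set `S` of at most `n + 1` points by numbers below `n + 1`; the points
outside `S` all get the number `n + 1`. -/
noncomputable def index {A : Type u} {n : ℕ} (S : Finset (Point A n)) (y : Point A n) :
    Fin (n + 2) :=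
  if h : y ∈ S then ⟨min n (S.equivFin ⟨y, h⟩), by omega⟩ else Fin.last _

section Index

variable {A : Type u} {n : ℕ} {S : Finset (Point A n)} {y z : Point A n}

theorem index_of_notMem (h : y ∉ S) : index S y = Fin.last _ := dif_neg h

theorem index_ne_last (h : y ∈ S) : index S y ≠ Fin.last _ := by
  rw [index, dif_pos h, Ne, Fin.ext_iff]
  simp only [Fin.val_last]
  omega

theorem eq_of_index_eq (hS : S.card ≤ n + 1) (hy : y ∈ S) (hz : z ∈ S)
    (h : index S y = index S z) : y = z := by
  have h1 := (S.equivFin ⟨y, hy⟩).2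
  have h2 := (S.equivFin ⟨z, hz⟩).2
  rw [index, dif_pos hy, index, dif_pos hz, Fin.mk.injEq] at h
  have h3 : S.equivFin ⟨y, hy⟩ = S.equivFin ⟨z, hz⟩ := by
    apply Fin.ext
    omega
  simpa using S.equivFin.injective h3

end Index

open Classical in
/-- Over every set `S₀` of at most `n + 1` points there is a new point `z` with prescribed type and
table that is the only designated point of `insert z S₀`: its colour does not occur in `S₀`, and its
residue makes the sum of all residues equal to its colour. -/
theorem exists_designated {A : Type u} {n : ℕ} (S₀ : Finset (Point A n)) (hS : S₀.card ≤ n + 1)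
    (t : Fin (n + 1) → Prop) (τ : Fin (n + 1) → (Fin (n + 1) → Fin (n + 2)) → Prop) :
    ∃ z : Point A n, z ∉ S₀ ∧ z.type = t ∧ z.table = τ ∧
      z.block = ∑ y ∈ insert z S₀, y.res ∧
      ∀ z' ∈ insert z S₀, z'.block = ∑ y ∈ insert z S₀, y.res → z' = z := by
  obtain ⟨i, hi⟩ : ∃ i, i ∉ S₀.image Point.block := by
    by_contra! h
    have h1 := Finset.card_le_card (fun i _ => h i : Finset.univ ⊆ S₀.image Point.block)
    have h2 := Finset.card_image_le (s := S₀) (f := Point.block)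
    rw [Finset.card_univ, ZMod.card] at h1
    omega
  have hi' : ∀ y ∈ S₀, y.block ≠ i := fun y hy h => hi (Finset.mem_image.2 ⟨y, hy, h⟩)
  let z : Point A n := ⟨i, i - ∑ y ∈ S₀, y.res, t, τ⟩
  have hz : z ∉ S₀ := fun h => hi' z h rfl
  have hsum : ∑ y ∈ insert z S₀, y.res = i := by
    rw [Finset.sum_insert hz]
    exact sub_add_cancel _ _
  refine ⟨z, hz, rfl, rfl, hsum.symm, fun z' hz' h => ?_⟩
  rcases Finset.mem_insert.1 hz' with h' | h'
  · exact h'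
  · exact absurd (h.trans hsum) (hi' z' h')

section Structure

variable {A : Type u} [Nonempty A] [sig.Structure A] {n : ℕ}

open Classical in
/-- An element of `A` that has the type of the given point, if the type is realized in `A`. -/
noncomputable def rep (d : Point A n) : A :=
  if h : ∃ a : A, typ n a = d.type then h.choose else Classical.arbitrary A

theorem typ_rep {d : Point A n} {a : A} (h : d.type = typ n a) : typ n (rep d) = typ n a := by
  have hex : ∃ a : A, typ n a = d.type := ⟨a, h.symm⟩
  rw [rep, dif_pos hex, hex.choose_spec, h]

open Classical in
/-- The map `π` from the points of `S` to `A` preserves types and the truth of formulas with code at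
most `n` is as the table of the point `z` says. Positions are taken in `S.erase z`, so that the
table of `z` does not enter into its own interpretation. -/
def Matches (S : Finset (Point A n)) (z : Point A n) (π : Point A n → A) : Prop :=
  (∀ y ∈ S, typ n (π y) = typ n (rep y)) ∧
    ∀ (c : Fin (n + 1)) (g : ℕ → Point A n), (∀ x, g x ∈ S) →
      ((ofNat c).Realize (π ∘ g) ↔ z.table c fun x => index (S.erase z) (g x))

open Classical in
/-- The map from the points of `S` to `A` along which the relations of `A` are pulled back to tuples
with set of entries `S`: as the designated point of `S` demands, if there is one and its demand can
be met. -/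
noncomputable def loc (S : Finset (Point A n)) : Point A n → A :=
  if h : ∃ π : Point A n → A, ∃ z ∈ S, z.block = ∑ y ∈ S, y.res ∧ Matches S z π then h.choose
  else rep

theorem typ_loc {S : Finset (Point A n)} {y : Point A n} (hy : y ∈ S) :
    typ n (loc S y) = typ n (rep y) := by
  rw [loc]
  split_ifs with h
  · obtain ⟨z, -, -, hz⟩ := h.choose_spec
    exact hz.1 y hy
  · rfl

open Classical in
/-- The finite model: a tuple of points is in a relation if its image under the map `loc` of its set
of entries is. Tuples with different sets of entries are thereby treated independently. -/
noncomputable instance : sig.Structure (Point A n) where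
  funMap f := f.elim
  RelMap {k} R ys := FirstOrder.Language.Structure.RelMap (L := sig) (M := A) (n := k) R
    fun i => loc (Finset.univ.image ys) (ys i)

open Classical in
/-- An atom on points holds if the corresponding tuple of elements of `A` satisfies it. -/
theorem realize_atom (R : ℕ) (args : List ℕ) (v : ℕ → Point A n) :
    (atom R args).Realize v ↔
      (atom R args).Realize (loc (args.toFinset.image v) ∘ v) := by
  have h : (Finset.univ.image fun i => v (args.get i)) = args.toFinset.image v := by
    ext y
    simp only [Finset.mem_image, Finset.mem_univ, true_and, List.mem_toFinset]
    constructor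
    · rintro ⟨i, rfl⟩
      exact ⟨_, List.get_mem _ _, rfl⟩
    · rintro ⟨x, hx, rfl⟩
      obtain ⟨i, rfl⟩ := List.get_of_mem hx
      exact ⟨i, rfl⟩
  rw [← h]
  rfl

/-- Over every small set of points there is a new point that has the type of a given element. -/
theorem exists_fresh (S₀ : Finset (Point A n)) (hS : S₀.card ≤ n + 1) (a : A) :
    ∃ z : Point A n, z ∉ S₀ ∧ typ n (rep z) = typ n a := by
  classical
  obtain ⟨z, hz, ht, -⟩ := exists_designated S₀ hS (typ n a) fun _ _ => True
  exact ⟨z, hz, typ_rep ht⟩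

/-! ### Transfer of blocks -/

/-- A finite partial play: the points `v x` and the elements `w x`, for `x ∈ P`, have the same types,
and equal points stand for equal elements. -/
def Similar (P : Finset ℕ) (v : ℕ → Point A n) (w : ℕ → A) : Prop :=
  (∀ x ∈ P, typ n (w x) = typ n (rep (v x))) ∧ ∀ x ∈ P, ∀ y ∈ P, v x = v y → w x = w y

theorem Similar.update {P : Finset ℕ} {v : ℕ → Point A n} {w : ℕ → A} (h : Similar P v w)
    {x : ℕ} (hx : x ∉ P) {d : Point A n} {a : A} (ht : typ n a = typ n (rep d))
    (hd : ∀ y ∈ P, v y = d → w y = a) :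
    Similar (insert x P) (Function.update v x d) (Function.update w x a) := by
  have hne : ∀ y ∈ P, y ≠ x := fun y hy e => hx (e ▸ hy)
  constructor
  · intro y hy
    rcases Finset.mem_insert.1 hy with rfl | hy
    · simpa using ht
    · simpa [hne y hy] using h.1 y hy
  · intro y hy z hz
    rw [Finset.mem_insert] at hy hz
    rcases hy with rfl | hy <;> rcases hz with rfl | hz
    · simp
    · simpa [hne z hz] using fun e : d = v z => (hd z hz e.symm).symm
    · simpa [hne y hy] using hd y hy
    · simpa [hne y hy, hne z hz] using h.2 y hy z hz

/-- The formula `χ` transfers from `A` to the points, for tuples of the same types, provided that its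
atoms with set of variables `V` do. -/
def TransfersOver (A : Type u) [Nonempty A] [sig.Structure A] (n : ℕ) (V : Finset ℕ)
    (χ : Formula) : Prop :=
  ∀ (v : ℕ → Point A n) (w : ℕ → A), (∀ x ∈ V, typ n (w x) = typ n (rep (v x))) →
    (∀ R args, args.toFinset = V → (atom R args).toNat ≤ n →
      ((atom R args).Realize w ↔ (atom R args).Realize v)) →
    χ.Realize w → χ.Realize v

/-- The last, existential, step of a play: the answer is the designated point of the set of all
points played, and its table describes the tuple of elements of `A`. -/
theorem exists_of_similar {P : Finset ℕ} {v : ℕ → Point A n} {w : ℕ → A} (h : Similar P v w)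
    (hP : P.card ≤ n + 1) {x : ℕ} (hx : x ∉ P) {χ : Formula}
    (hχ : TransfersOver A n (insert x P) χ) {a : A} (ha : χ.Realize (Function.update w x a)) :
    ∃ d : Point A n, χ.Realize (Function.update v x d) := by
  classical
  set S₀ := P.image v with hS₀
  have hc : S₀.card ≤ n + 1 := Finset.card_image_le.trans hP
  have hmem : ∀ p ∈ P, v p ∈ S₀ := fun p hp => Finset.mem_image_of_mem v hp
  -- The elements of `A` in terms of the positions of points; the last position is that of the answer.
  let π₀ : Fin (n + 2) → A := fun k =>
    if hk : ∃ p ∈ P, index S₀ (v p) = k then w hk.choose else a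
  have hπ₀ : ∀ p ∈ P, π₀ (index S₀ (v p)) = w p := by
    intro p hp
    have hk : ∃ q ∈ P, index S₀ (v q) = index S₀ (v p) := ⟨p, hp, rfl⟩
    have hs := hk.choose_spec
    simp only [π₀, dif_pos hk]
    exact h.2 _ hs.1 _ hp (eq_of_index_eq hc (hmem _ hs.1) (hmem _ hp) hs.2)
  have hπ₀a : π₀ (Fin.last _) = a := by
    refine dif_neg ?_
    rintro ⟨p, hp, e⟩
    exact index_ne_last (hmem p hp) e
  obtain ⟨z, hz, ht, hτ, hb, hu⟩ := exists_designated S₀ hc (typ n a)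
    fun c k => (ofNat c).Realize fun y => π₀ (k (Fin.ofNat (n + 1) y))
  refine ⟨z, ?_⟩
  set S := insert z S₀ with hS
  have herase : S.erase z = S₀ := Finset.erase_insert hz
  have hzπ : π₀ (index S₀ z) = a := by rw [index_of_notMem hz, hπ₀a]
  have hsim := h.update (d := z) (a := a) hx (typ_rep ht).symm
    fun p hp e => absurd (e ▸ hmem p hp) hz
  have hM : Matches S z fun y => π₀ (index S₀ y) := by
    constructor
    · intro y hy
      rcases Finset.mem_insert.1 hy with rfl | hy
      · change typ n (π₀ _) = _
        rw [hzπ, typ_rep ht]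
      · obtain ⟨p, hp, rfl⟩ := Finset.mem_image.1 hy
        change typ n (π₀ _) = _
        rw [hπ₀ p hp, h.1 p hp]
    · intro c g _
      rw [hτ, herase]
      refine realize_congr fun y hy => ?_
      have hy' := le_toNat_of_mem_fv hy
      rw [toNat_ofNat] at hy'
      have : y % (n + 1) = y := Nat.mod_eq_of_lt (by omega)
      simp [this]
  have hloc : Matches S z (loc S) := by
    have hex : ∃ π : Point A n → A, ∃ z ∈ S, z.block = ∑ y ∈ S, y.res ∧ Matches S z π :=
      ⟨_, z, Finset.mem_insert_self _ _, hb, hM⟩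
    obtain ⟨z', hz', hb', hm⟩ := hex.choose_spec
    rw [hu z' hz' hb'] at hm
    rwa [loc, dif_pos hex]
  have himage : (insert x P).image (Function.update v x z) = S := by
    rw [Finset.image_insert, Function.update_self, hS, hS₀]
    congr 1
    refine Finset.image_congr fun p hp => Function.update_of_ne ?_ _ _
    rintro rfl
    exact hx hp
  have hval : ∀ y ∈ insert x P, Function.update w x a y =
      π₀ (index S₀ (Function.update v x z y)) := by
    intro y hy
    rcases Finset.mem_insert.1 hy with rfl | hy
    · simp [hzπ]
    · have hne : y ≠ x := fun e => hx (e ▸ hy)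
      simp [hne, hπ₀ y hy]
  refine hχ _ _ hsim.1 (fun R args hargs hn => ?_) ha
  rw [realize_atom, hargs, himage]
  -- Outside of the variables of the atom the assignment is immaterial, but has to stay in `S`.
  let g : ℕ → Point A n := fun y => if y ∈ insert x P then Function.update v x z y else z
  have hg : ∀ y, g y ∈ S := by
    intro y
    simp only [g]
    split_ifs with hy
    · rw [← himage]
      exact Finset.mem_image_of_mem _ hy
    · exact Finset.mem_insert_self _ _
  have h1 := (hM.2 ⟨_, Nat.lt_succ_of_le hn⟩ g hg).trans
    (hloc.2 ⟨_, Nat.lt_succ_of_le hn⟩ g hg).symm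
  simp only [ofNat_toNat] at h1
  have hgv : ∀ y ∈ (atom R args).fv, y ∈ insert x P := fun y hy => by
    simpa [fv, ← hargs] using hy
  rw [realize_congr (w := (fun y => π₀ (index S₀ y)) ∘ g), h1]
  · refine realize_congr fun y hy => ?_
    simp only [g, Function.comp_apply, if_pos (hgv y hy)]
  · intro y hy
    simp only [g, Function.comp_apply, if_pos (hgv y hy), hval y (hgv y hy)]

/-- Blocks that end with an existential quantifier, by simulating a play for the block over the
points by a play over `A`. -/
theorem realize_quantify_of_similar {χ : Formula} (b : List (Quantifier × ℕ)) {P : Finset ℕ}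
    (hb : (b.map Prod.fst).getLast? = some Quantifier.ex) (hnd : (b.map Prod.snd).Nodup)
    (hP : Disjoint P (blockVars b)) (hc : P.card + b.length ≤ n + 2)
    (hχ : TransfersOver A n (P ∪ blockVars b) χ) {v : ℕ → Point A n} {w : ℕ → A}
    (h : Similar P v w) (hw : (quantify b χ).Realize w) : (quantify b χ).Realize v := by
  classical
  induction b generalizing P v w with
  | nil => simp at hb
  | cons q b ih =>
    obtain ⟨q, x⟩ := q
    simp only [List.map_cons, List.nodup_cons, List.length_cons, blockVars_cons,
      Finset.disjoint_insert_right] at hnd hc hP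
    have hc' : P.card ≤ n + 1 := by omega
    have hcx : (insert x P).card + b.length ≤ n + 2 := by
      rw [Finset.card_insert_of_notMem hP.1]
      omega
    have hdx : Disjoint (insert x P) (blockVars b) :=
      Finset.disjoint_insert_left.2 ⟨by simpa [blockVars] using hnd.1, hP.2⟩
    have hχx : TransfersOver A n (insert x P ∪ blockVars b) χ := by
      rwa [blockVars_cons, Finset.union_insert, ← Finset.insert_union] at hχ
    rcases b with _ | ⟨q', b⟩
    · obtain rfl : q = Quantifier.ex := by simpa using hb
      obtain ⟨a, ha⟩ := hw
      exact exists_of_similar h hc' hP.1 (by simpa [quantify] using hχx) ha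
    · have hb' : (((q' :: b).map Prod.fst)).getLast? = some Quantifier.ex := by
        simpa using hb
      have ih := fun {v w} => ih (v := v) (w := w) hb' hnd.2 hdx hcx hχx
      cases q with
      | all =>
        intro d
        by_cases hd : ∃ p ∈ P, v p = d
        · obtain ⟨p, hp, rfl⟩ := hd
          exact ih (h.update hP.1 (h.1 p hp) fun y hy e => h.2 y hy p hp e) (hw (w p))
        · exact ih (h.update hP.1 rfl fun y hy e => absurd ⟨y, hy, e⟩ hd) (hw (rep d))
      | ex =>
        obtain ⟨a, ha⟩ := hw
        obtain ⟨z, hz, ht⟩ := exists_fresh (P.image v) (Finset.card_image_le.trans hc') a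
        exact ⟨z, ih (h.update hP.1 ht.symm fun y hy e =>
          absurd (e ▸ Finset.mem_image_of_mem v hy) hz) ha⟩

/-- Universal blocks: the tuples of points with set of entries `S` look like the tuples of elements
of `A` that `loc S` assigns to them. -/
theorem realize_quantify_of_universal {χ : Formula} {b : List (Quantifier × ℕ)} {P : Finset ℕ}
    (hb : ∀ q ∈ b.map Prod.fst, q = Quantifier.all) (hP : Disjoint P (blockVars b))
    (hc : P.card ≤ 1) (hn : (quantify b χ).toNat ≤ n) (hfv : χ.fv ⊆ P ∪ blockVars b)
    (hχ : TransfersOver A n (P ∪ blockVars b) χ) {v : ℕ → Point A n} {w : ℕ → A}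
    (h : ∀ x ∈ (quantify b χ).fv, typ n (w x) = typ n (rep (v x)))
    (hw : (quantify b χ).Realize w) : (quantify b χ).Realize v := by
  classical
  rw [realize_quantify_universal_iff hb]
  intro v' hv'
  set S := (P ∪ blockVars b).image v' with hS
  have hmem : ∀ x ∈ P ∪ blockVars b, v' x ∈ S := fun x hx => Finset.mem_image_of_mem _ hx
  have hsub : (quantify b χ).fv ⊆ P := by
    rw [fv_quantify]
    intro x hx
    rw [Finset.mem_sdiff] at hx
    exact (Finset.mem_union.1 (hfv hx.1)).resolve_right hx.2
  have hw' : (quantify b χ).Realize (loc S ∘ v') := by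
    refine (realize_iff_of_typ_eq hn ((Finset.card_le_card hsub).trans hc) fun x hx => ?_).1 hw
    have hxP := hsub hx
    rw [Function.comp_apply, typ_loc (hmem x (Finset.mem_union_left _ hxP)), h x hx,
      hv' x (Finset.disjoint_left.1 hP hxP)]
  refine hχ v' (loc S ∘ v') (fun x hx => typ_loc (hmem x hx)) (fun R args hargs _ => ?_)
    ((realize_quantify_universal_iff hb _ _).1 hw' _ fun _ _ => rfl)
  rw [realize_atom, hargs]

/-- Blocks with at most one parameter, the variable in `P`. -/
theorem realize_quantify_of_admissible {χ : Formula} {b : List (Quantifier × ℕ)} {P : Finset ℕ}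
    (hb : Admissible (b.map Prod.fst)) (hnd : (b.map Prod.snd).Nodup)
    (hP : Disjoint P (blockVars b)) (hc : P.card ≤ 1) (hn : (quantify b χ).toNat ≤ n)
    (hfv : χ.fv ⊆ P ∪ blockVars b) (hχ : TransfersOver A n (P ∪ blockVars b) χ)
    {v : ℕ → Point A n} {w : ℕ → A}
    (h : ∀ x ∈ (quantify b χ).fv, typ n (w x) = typ n (rep (v x)))
    (hw : (quantify b χ).Realize w) : (quantify b χ).Realize v := by
  rcases hb with hb | hb
  · exact realize_quantify_of_universal hb hP hc hn hfv hχ h hw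
  · have hlen := toNat_add_length_le b χ
    -- A parameter that is not free in the block may be sent to an arbitrary element of the right type.
    let w' : ℕ → A := fun x => if x ∈ (quantify b χ).fv then w x else loc {v x} (v x)
    refine realize_quantify_of_similar b hb hnd hP (by omega) hχ (w := w') ⟨fun x _ => ?_, ?_⟩ ?_
    · by_cases hx : x ∈ (quantify b χ).fv
      · simpa [w', hx] using h x hx
      · simpa [w', hx] using typ_loc (Finset.mem_singleton_self (v x))
    · intro x hx y hy _
      rw [Finset.card_le_one.1 hc x hx y hy]
    · exact (realize_congr fun x hx => by simp [w', hx]).1 hw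

end Structure

end Point

/-! ### The small model property -/

theorem IsComb.fv_subset {V : Finset ℕ} {χ : Formula} (h : IsComb V χ) : χ.fv ⊆ V := by
  refine IsComb.rec (motive_1 := fun _ _ => True) (motive_2 := fun V χ _ => χ.fv ⊆ V)
    (fun _ _ _ => trivial) (fun _ _ _ => trivial) (fun _ _ _ _ => trivial)
    (fun _ _ _ _ => trivial) (fun _ _ _ _ _ _ _ => trivial) (fun _ _ _ _ _ _ _ => trivial)
    (fun _ hV _ => hV) (fun R args h => ?_) (fun R args h => ?_) (fun _ _ h1 h2 => ?_)
    (fun _ _ h1 h2 => ?_) h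
  · exact h.le
  · exact h.le
  · exact Finset.union_subset h1 h2
  · exact Finset.union_subset h1 h2

section Transfer

variable (A : Type u) [Nonempty A] [sig.Structure A] (n : ℕ)

theorem realize_atom_iff_of_typ_eq {R : ℕ} {args : List ℕ} (h : args.toFinset.card ≤ 1)
    (hn : (atom R args).toNat ≤ n) {v : ℕ → Point A n} {w : ℕ → A}
    (ht : ∀ x ∈ args.toFinset, typ n (w x) = typ n (Point.rep (v x))) :
    (atom R args).Realize w ↔ (atom R args).Realize v := by
  classical
  rw [Point.realize_atom]
  refine realize_iff_of_typ_eq hn h fun x hx => ?_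
  rw [fv] at hx
  rw [ht x hx, Function.comp_apply, Point.typ_loc (Finset.mem_image_of_mem _ hx)]

/-- The formulas of `AUF₁⁻` with code at most `n` transfer from `A` to the points. -/
theorem IsAUFm.realize_of_typ_eq {φ : Formula} (h : IsAUFm φ) : φ.toNat ≤ n →
    ∀ (v : ℕ → Point A n) (w : ℕ → A), (∀ x ∈ φ.fv, typ n (w x) = typ n (Point.rep (v x))) →
      φ.Realize w → φ.Realize v := by
  refine IsAUFm.rec
    (motive_1 := fun φ _ => φ.toNat ≤ n → ∀ (v : ℕ → Point A n) (w : ℕ → A),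
      (∀ x ∈ φ.fv, typ n (w x) = typ n (Point.rep (v x))) → φ.Realize w → φ.Realize v)
    (motive_2 := fun V χ _ => χ.toNat ≤ n → Point.TransfersOver A n V χ)
    ?_ ?_ ?_ ?_ ?_ ?_ ?_ ?_ ?_ ?_ ?_ h
  · intro R args h hn v w ht
    exact (realize_atom_iff_of_typ_eq A n h hn ht).1
  · intro R args h hn v w ht
    rw [natom_toNat] at hn
    exact mt (realize_atom_iff_of_typ_eq A n h (by omega) ht).2
  · intro φ ψ _ _ h1 h2 hn v w ht
    have := and_bounds φ ψ
    exact And.imp (h1 (by omega) v w fun x hx => ht x (Finset.mem_union_left _ hx))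
      (h2 (by omega) v w fun x hx => ht x (Finset.mem_union_right _ hx))
  · intro φ ψ _ _ h1 h2 hn v w ht
    have := or_bounds φ ψ
    exact Or.imp (h1 (by omega) v w fun x hx => ht x (Finset.mem_union_left _ hx))
      (h2 (by omega) v w fun x hx => ht x (Finset.mem_union_right _ hx))
  · intro b χ _ hx hQ hχ ih hn v w ht
    have := toNat_add_length_le b χ
    exact Point.realize_quantify_of_admissible (P := ∅) hQ hx (by simp) (by simp) hn
      (by rw [Finset.empty_union]; exact hχ.fv_subset)
      (by rw [Finset.empty_union]; exact ih (by omega)) ht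
  · intro x₀ b χ hx hQ hχ ih hn v w ht
    have := toNat_add_length_le b χ
    have hV : (x₀ :: b.map Prod.snd).toFinset = {x₀} ∪ blockVars b := by
      rw [List.toFinset_cons, blockVars, Finset.insert_eq]
    rw [hV] at hχ ih
    rw [List.nodup_cons] at hx
    exact Point.realize_quantify_of_admissible (P := {x₀}) hQ hx.2
      (by simpa [blockVars] using hx.1) (by simp) hn hχ.fv_subset (ih (by omega)) ht
  · intro V φ _ hV ih hn v w ht _
    exact ih hn v w fun x hx => ht x (hV hx)
  · intro V R args h hn v w _ hat
    exact (hat R args h hn).1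
  · intro V R args h hn v w _ hat
    rw [natom_toNat] at hn
    exact mt (hat R args h (by omega)).2
  · intro V φ ψ _ _ h1 h2 hn v w ht hat
    have := and_bounds φ ψ
    exact And.imp (h1 (by omega) v w ht hat) (h2 (by omega) v w ht hat)
  · intro V φ ψ _ _ h1 h2 hn v w ht hat
    have := or_bounds φ ψ
    exact Or.imp (h1 (by omega) v w ht hat) (h2 (by omega) v w ht hat)

end Transfer

/-- The structure on `B` that a structure on `A` induces along a map from `B` to `A`. -/
abbrev pullback {A : Type*} {B : Type*} [sig.Structure A] (f : B → A) : sig.Structure B where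
  funMap g := g.elim
  RelMap {k} R ys := FirstOrder.Language.Structure.RelMap (L := sig) (M := A) (n := k) R (f ∘ ys)

theorem realize_pullback {A : Type*} {B : Type*} [sig.Structure A] {f : B → A}
    (hf : Function.Surjective f) (φ : Formula) (v : ℕ → B) :
    letI := pullback f
    φ.Realize v ↔ φ.Realize (f ∘ v) :=
  letI := pullback f
  realize_comp_of_surjective hf (fun _ _ _ => Iff.rfl) φ v

/-- The small model property: a satisfiable sentence of `AUF₁⁻` has a model whose size is a function
of the code of the sentence. -/
theorem satisfiable_iff_exists_fin {φ : Formula} (hφ : IsAUFm φ) (hs : φ.IsSentence) :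
    Satisfiable.{u} φ ↔
      ∃ _ : sig.Structure (Fin (modelSize φ.toNat)), ∃ v : ℕ → Fin (modelSize φ.toNat),
        φ.Realize v := by
  have hs : φ.fv = ∅ := hs
  constructor
  · rintro ⟨A, _, _, hA⟩
    obtain ⟨z, -⟩ := Point.exists_fresh (∅ : Finset (Point A φ.toNat)) (by simp)
      (Classical.arbitrary A)
    let e : Fin (modelSize φ.toNat) ≃ Point A φ.toNat :=
      (Finite.equivFinOfCardEq (Point.card_eq A φ.toNat)).symm
    refine ⟨pullback e, fun _ => e.symm z, (realize_pullback e.surjective φ _).2 ?_⟩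
    exact hφ.realize_of_typ_eq A φ.toNat le_rfl _ (fun _ => Classical.arbitrary A)
      (by simp [hs]) (hA _)
  · rintro ⟨_, v, hv⟩
    refine ⟨ULift (Fin (modelSize φ.toNat)), ⟨⟨v 0⟩⟩, pullback ULift.down, fun w => ?_⟩
    rw [realize_pullback ULift.down_surjective]
    exact (realize_congr (by simp [hs])).1 hv

/-! ### Primitive recursion over formulas -/

section Recursion

theorem getElem?_map_range {σ : Type*} (f : ℕ → σ) {i n : ℕ} (h : i < n) :
    ((List.range n).map f)[i]? = some (f i) := by
  simp [h]

theorem denumerable_ofNat_formula (n : ℕ) : Denumerable.ofNat Formula n = ofNat n :=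
  Denumerable.ofNat_of_decode rfl

theorem primrec_ofNat : Primrec ofNat :=
  (Primrec.ofNat Formula).of_eq denumerable_ofNat_formula

theorem primrec_toNat : Primrec toNat := Primrec.encode

/-- One step of a course-of-values recursion over codes of formulas: the value at the formula whose
code is the length of `l`, where `l` is the list of the values at the formulas with smaller codes. -/
def recStep {α σ : Type*} (fa fn : α → Formula × ℕ × List ℕ → σ)
    (fconj fdisj : α → Formula × σ × σ → σ) (fall fex : α → Formula × ℕ × σ → σ) (a : α)
    (l : List σ) : Option σ :=
  let φ := ofNat l.length
  let d := (l.length / 6).unpair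
  if l.length % 6 = 0 then some (fa a (φ, d.1, Denumerable.ofNat (List ℕ) d.2))
  else if l.length % 6 = 1 then some (fn a (φ, d.1, Denumerable.ofNat (List ℕ) d.2))
  else l[d.2]?.bind fun s =>
    if l.length % 6 = 4 then some (fall a (φ, d.1, s))
    else if l.length % 6 = 5 then some (fex a (φ, d.1, s))
    else l[d.1]?.bind fun r =>
      if l.length % 6 = 2 then some (fconj a (φ, r, s)) else some (fdisj a (φ, r, s))

theorem primrec_recStep {α σ : Type*} [Primcodable α] [Primcodable σ]
    {fa fn : α → Formula × ℕ × List ℕ → σ} {fconj fdisj : α → Formula × σ × σ → σ}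
    {fall fex : α → Formula × ℕ × σ → σ} (ha : Primrec₂ fa) (hn : Primrec₂ fn)
    (hand : Primrec₂ fconj) (hor : Primrec₂ fdisj) (hall : Primrec₂ fall) (hex : Primrec₂ fex) :
    Primrec₂ (recStep fa fn fconj fdisj fall fex) := by
  have hlen : Primrec fun p : α × List σ => p.2.length := Primrec.list_length.comp Primrec.snd
  have hmod : Primrec fun p : α × List σ => p.2.length % 6 :=
    Primrec.nat_mod.comp hlen (Primrec.const 6)
  have hc : ∀ k, PrimrecPred fun p : α × List σ => p.2.length % 6 = k := fun k =>
    Primrec.eq.comp hmod (Primrec.const k)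
  have hφ : Primrec fun p : α × List σ => ofNat p.2.length := primrec_ofNat.comp hlen
  have hd : Primrec fun p : α × List σ => (p.2.length / 6).unpair :=
    Primrec.unpair.comp (Primrec.nat_div.comp hlen (Primrec.const 6))
  have hd1 := Primrec.fst.comp hd
  have hd2 := Primrec.snd.comp hd
  have hargs := (Primrec.ofNat (List ℕ)).comp hd2
  have hat := Primrec.pair hφ (Primrec.pair hd1 hargs)
  refine Primrec.ite (hc 0) (Primrec.option_some.comp (ha.comp Primrec.fst hat)) ?_
  refine Primrec.ite (hc 1) (Primrec.option_some.comp (hn.comp Primrec.fst hat)) ?_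
  refine Primrec.option_bind (Primrec.list_getElem?.comp Primrec.snd hd2) ?_
  have hq : Primrec fun p : (α × List σ) × σ =>
      (ofNat p.1.2.length, (p.1.2.length / 6).unpair.1, p.2) :=
    (hφ.comp Primrec.fst).pair ((hd1.comp Primrec.fst).pair Primrec.snd)
  have ha1 : Primrec fun p : (α × List σ) × σ => p.1.1 := Primrec.fst.comp Primrec.fst
  refine Primrec.ite ((hc 4).comp Primrec.fst) (Primrec.option_some.comp (hall.comp ha1 hq)) ?_
  refine Primrec.ite ((hc 5).comp Primrec.fst) (Primrec.option_some.comp (hex.comp ha1 hq)) ?_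
  refine Primrec.option_bind (Primrec.list_getElem?.comp (Primrec.snd.comp Primrec.fst)
    (hd1.comp Primrec.fst)) ?_
  have hb : Primrec fun p : ((α × List σ) × σ) × σ => (ofNat p.1.1.2.length, p.2, p.1.2) :=
    (hφ.comp (Primrec.fst.comp Primrec.fst)).pair
      (Primrec.snd.pair (Primrec.snd.comp Primrec.fst))
  have ha2 := ha1.comp (Primrec.fst (α := (α × List σ) × σ) (β := σ))
  exact Primrec.ite ((hc 2).comp (Primrec.fst.comp Primrec.fst))
    (Primrec.option_some.comp (hand.comp ha2 hb)) (Primrec.option_some.comp (hor.comp ha2 hb))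

/-- A function that is defined from primitive recursive functions by recursion over formulas is
primitive recursive. -/
theorem primrec_of_formula_rec {α σ : Type*} [Primcodable α] [Primcodable σ] {F : α → Formula → σ}
    {fa fn : α → Formula × ℕ × List ℕ → σ} {fconj fdisj : α → Formula × σ × σ → σ}
    {fall fex : α → Formula × ℕ × σ → σ} (ha : Primrec₂ fa) (hn : Primrec₂ fn)
    (hand : Primrec₂ fconj) (hor : Primrec₂ fdisj) (hall : Primrec₂ fall) (hex : Primrec₂ fex)
    (Ha : ∀ a R args, F a (atom R args) = fa a (atom R args, R, args))
    (Hn : ∀ a R args, F a (natom R args) = fn a (natom R args, R, args))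
    (Hand : ∀ a φ ψ, F a (φ.and ψ) = fconj a (φ.and ψ, F a φ, F a ψ))
    (Hor : ∀ a φ ψ, F a (φ.or ψ) = fdisj a (φ.or ψ, F a φ, F a ψ))
    (Hall : ∀ a x φ, F a (all x φ) = fall a (all x φ, x, F a φ))
    (Hex : ∀ a x φ, F a (ex x φ) = fex a (ex x φ, x, F a φ)) : Primrec₂ F := by
  have key : Primrec₂ fun a n => F a (ofNat n) := by
    refine Primrec.nat_strong_rec _ (primrec_recStep ha hn hand hor hall hex) fun a n => ?_
    suffices ∀ φ : Formula, recStep fa fn fconj fdisj fall fex a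
        ((List.range φ.toNat).map fun n => F a (ofNat n)) = some (F a φ) by
      simpa only [toNat_ofNat] using this (ofNat n)
    intro φ
    have look : ∀ ψ : Formula, ψ.toNat < φ.toNat →
        ((List.range φ.toNat).map fun n => F a (ofNat n))[ψ.toNat]? = some (F a ψ) := fun ψ h => by
      rw [getElem?_map_range _ h, ofNat_toNat]
    simp only [recStep, List.length_map, List.length_range, ofNat_toNat]
    cases φ with
    | atom R args =>
      have h6 : (atom R args).toNat % 6 = 0 := by simp only [Formula.toNat]; omega
      have hd : (atom R args).toNat / 6 = Nat.pair R (Encodable.encode args) := by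
        simp only [Formula.toNat]; omega
      simp [h6, hd, Ha]
    | natom R args =>
      have h6 : (natom R args).toNat % 6 = 1 := by simp only [Formula.toNat]; omega
      have hd : (natom R args).toNat / 6 = Nat.pair R (Encodable.encode args) := by
        simp only [Formula.toNat]; omega
      simp [h6, hd, Hn]
    | and φ ψ =>
      have h6 : (φ.and ψ).toNat % 6 = 2 := by simp only [Formula.toNat]; omega
      have hd : (φ.and ψ).toNat / 6 = Nat.pair φ.toNat ψ.toNat := by simp only [Formula.toNat]; omega
      have hb := and_bounds φ ψ
      simp only [h6, hd, Nat.unpair_pair, look φ hb.1, look ψ hb.2]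
      simp [Hand]
    | or φ ψ =>
      have h6 : (φ.or ψ).toNat % 6 = 3 := by simp only [Formula.toNat]; omega
      have hd : (φ.or ψ).toNat / 6 = Nat.pair φ.toNat ψ.toNat := by simp only [Formula.toNat]; omega
      have hb := or_bounds φ ψ
      simp only [h6, hd, Nat.unpair_pair, look φ hb.1, look ψ hb.2]
      simp [Hor]
    | all x φ =>
      have h6 : (all x φ).toNat % 6 = 4 := by simp only [Formula.toNat]; omega
      have hd : (all x φ).toNat / 6 = Nat.pair x φ.toNat := by simp only [Formula.toNat]; omega
      simp only [h6, hd, Nat.unpair_pair, look φ (all_bounds x φ).2]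
      simp [Hall]
    | ex x φ =>
      have h6 : (ex x φ).toNat % 6 = 5 := by simp only [Formula.toNat]; omega
      have hd : (ex x φ).toNat / 6 = Nat.pair x φ.toNat := by simp only [Formula.toNat]; omega
      simp only [h6, hd, Nat.unpair_pair, look φ (ex_bounds x φ).2]
      simp [Hex]
  exact (key.comp₂ Primrec₂.left (primrec_toNat.comp₂ Primrec₂.right)).of_eq fun a φ => by
    rw [ofNat_toNat]

end Recursion

/-! ### Primitive recursive predicates on lists -/

section Lists

variable {α β : Type*} [Primcodable α] [Primcodable β]

theorem primrecPred_exists_mem {f : α → List β} {R : α → β → Prop} (hf : Primrec f)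
    (hR : PrimrecPred fun p : α × β => R p.1 p.2) : PrimrecPred fun a => ∃ b ∈ f a, R a b :=
  (PrimrecRel.exists_mem_list (R := fun b a => R a b)
    (hR.comp (Primrec.snd.pair Primrec.fst)).primrecRel).comp hf Primrec.id

theorem primrecPred_forall_mem {f : α → List β} {R : α → β → Prop} (hf : Primrec f)
    (hR : PrimrecPred fun p : α × β => R p.1 p.2) : PrimrecPred fun a => ∀ b ∈ f a, R a b :=
  (PrimrecRel.forall_mem_list (R := fun b a => R a b)
    (hR.comp (Primrec.snd.pair Primrec.fst)).primrecRel).comp hf Primrec.id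

theorem primrecPred_mem {f : α → β} {g : α → List β} (hf : Primrec f) (hg : Primrec g) :
    PrimrecPred fun a => f a ∈ g a :=
  (primrecPred_exists_mem (R := fun a b => b = f a) hg
    (Primrec.eq.comp Primrec.snd (hf.comp Primrec.fst))).of_eq fun a => by simp

theorem primrecPred_subset {f g : α → List β} (hf : Primrec f) (hg : Primrec g) :
    PrimrecPred fun a => f a ⊆ g a :=
  primrecPred_forall_mem (R := fun a b => b ∈ g a) hf
    (primrecPred_mem Primrec.snd (hg.comp Primrec.fst))

theorem primrec_filter {f : α → List β} {R : α → β → Prop} [∀ a, DecidablePred (R a)]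
    (hf : Primrec f) (hR : PrimrecPred fun p : α × β => R p.1 p.2) :
    Primrec fun a => (f a).filter fun b => R a b := by
  classical
  have h := (PrimrecRel.listFilter (R := fun b a => R a b)
    (hR.comp (Primrec.snd.pair Primrec.fst)).primrecRel).comp hf Primrec.id
  exact h.of_eq fun a => List.filter_congr fun b _ => by simp

end Lists

/-! ### Recognizing the formulas of the logic -/

section Inversion

theorem quantify_eq_of_ne_nil {b : List (Quantifier × ℕ)} (hb : b ≠ []) (χ : Formula) :
    ∃ x ψ, quantify b χ = all x ψ ∨ quantify b χ = ex x ψ := by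
  rcases b with _ | ⟨⟨q, x⟩, b⟩
  · exact absurd rfl hb
  · cases q
    · exact ⟨x, quantify b χ, Or.inl rfl⟩
    · exact ⟨x, quantify b χ, Or.inr rfl⟩

/-- The blocks of length zero with one parameter give nothing new. -/
theorem IsComb.isAUFm_of_card_le_one {V : Finset ℕ} {χ : Formula} (h : IsComb V χ) :
    V.card ≤ 1 → IsAUFm χ := by
  refine IsComb.rec (motive_1 := fun _ _ => True)
    (motive_2 := fun V χ _ => V.card ≤ 1 → IsAUFm χ)
    (fun _ _ _ => trivial) (fun _ _ _ => trivial) (fun _ _ _ _ => trivial)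
    (fun _ _ _ _ => trivial) (fun _ _ _ _ _ _ _ => trivial) (fun _ _ _ _ _ _ _ => trivial)
    (fun hφ _ _ _ => hφ) (fun R args h hV => ?_) (fun R args h hV => ?_) (fun _ _ h1 h2 hV => ?_)
    (fun _ _ h1 h2 hV => ?_) h
  · exact .atom R args (by rwa [h])
  · exact .natom R args (by rwa [h])
  · exact IsAUFm.and (h1 hV) (h2 hV)
  · exact IsAUFm.or (h1 hV) (h2 hV)

theorem IsComb.erase {V : Finset ℕ} {χ : Formula} (h : IsComb V χ) {x : ℕ} (hxV : x ∈ V) :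
    x ∉ χ.fv → IsComb (V.erase x) χ := by
  revert hxV
  refine IsComb.rec (motive_1 := fun _ _ => True)
    (motive_2 := fun V χ _ => x ∈ V → x ∉ χ.fv → IsComb (V.erase x) χ)
    (fun _ _ _ => trivial) (fun _ _ _ => trivial) (fun _ _ _ _ => trivial)
    (fun _ _ _ _ => trivial) (fun _ _ _ _ _ _ _ => trivial) (fun _ _ _ _ _ _ _ => trivial)
    (fun hφ hV _ _ hx => ?_) (fun R args h hV hx => ?_) (fun R args h hV hx => ?_)
    (fun _ _ h1 h2 hV hx => ?_) (fun _ _ h1 h2 hV hx => ?_) h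
  · exact IsComb.mem hφ (Finset.subset_erase.2 ⟨hV, hx⟩)
  · exact absurd (by rwa [← h] at hV) hx
  · exact absurd (by rwa [← h] at hV) hx
  · simp only [fv, Finset.mem_union, not_or] at hx
    exact IsComb.and (h1 hV hx.1) (h2 hV hx.2)
  · simp only [fv, Finset.mem_union, not_or] at hx
    exact IsComb.or (h1 hV hx.1) (h2 hV hx.2)

/-- The condition for membership in `AUF₁⁻` in terms of the outermost connective of a formula. In a
block with a parameter `x₀` the parameter may be taken to occur: a block that satisfies the
conditions for an `x₀` that does not occur also satisfies those for a block without parameter. -/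
def Shape : Formula → Prop
  | Formula.atom _ args => args.toFinset.card ≤ 1
  | Formula.natom _ args => args.toFinset.card ≤ 1
  | Formula.and φ ψ => IsAUFm φ ∧ IsAUFm ψ
  | Formula.or φ ψ => IsAUFm φ ∧ IsAUFm ψ
  | φ => ∃ b χ, φ = quantify b χ ∧ b ≠ [] ∧ (b.map Prod.snd).Nodup ∧
      Admissible (b.map Prod.fst) ∧ (IsComb (blockVars b) χ ∨
        ∃ x₀ ∈ φ.fv, IsComb (insert x₀ (blockVars b)) χ)

theorem shape_quantify {b : List (Quantifier × ℕ)} {χ : Formula} (hb : b ≠ []) :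
    Shape (quantify b χ) ↔ ∃ c ψ, quantify b χ = quantify c ψ ∧ c ≠ [] ∧ (c.map Prod.snd).Nodup ∧
      Admissible (c.map Prod.fst) ∧ (IsComb (blockVars c) ψ ∨
        ∃ x₀ ∈ (quantify b χ).fv, IsComb (insert x₀ (blockVars c)) ψ) := by
  obtain ⟨x, ψ, h | h⟩ := quantify_eq_of_ne_nil hb χ <;> rw [h] <;> rfl

theorem IsAUFm.shape {φ : Formula} (h : IsAUFm φ) : Shape φ := by
  refine IsAUFm.rec (motive_1 := fun φ _ => Shape φ)
    (motive_2 := fun V χ _ => V.card ≤ 1 → Shape χ)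
    ?_ ?_ ?_ ?_ ?_ ?_ ?_ ?_ ?_ ?_ ?_ h
  · exact fun R args h => h
  · exact fun R args h => h
  · exact fun h1 h2 _ _ => ⟨h1, h2⟩
  · exact fun h1 h2 _ _ => ⟨h1, h2⟩
  · exact fun b χ hne hx hQ hχ _ =>
      (shape_quantify hne).2 ⟨b, χ, rfl, hne, hx, hQ, Or.inl hχ⟩
  · intro x₀ b χ hx hQ hχ ih
    rw [List.nodup_cons] at hx
    rw [List.toFinset_cons] at hχ ih
    rcases eq_or_ne b [] with rfl | hne
    · exact ih (by simp)
    · refine (shape_quantify hne).2 ⟨b, χ, rfl, hne, hx.2, hQ, ?_⟩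
      by_cases hfv : x₀ ∈ χ.fv
      · refine Or.inr ⟨x₀, ?_, hχ⟩
        rw [fv_quantify, Finset.mem_sdiff]
        exact ⟨hfv, by simpa [blockVars] using hx.1⟩
      · have := hχ.erase (Finset.mem_insert_self _ _) hfv
        rw [Finset.erase_insert (by simpa using hx.1)] at this
        exact Or.inl this
  · exact fun _ _ ih _ => ih
  · exact fun {V} R args h hV => show args.toFinset.card ≤ 1 by rwa [h]
  · exact fun {V} R args h hV => show args.toFinset.card ≤ 1 by rwa [h]
  · exact fun h1 h2 _ _ hV => ⟨h1.isAUFm_of_card_le_one hV, h2.isAUFm_of_card_le_one hV⟩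
  · exact fun h1 h2 _ _ hV => ⟨h1.isAUFm_of_card_le_one hV, h2.isAUFm_of_card_le_one hV⟩

theorem isAUFm_of_block {φ : Formula} (h : ∃ b χ, φ = quantify b χ ∧ b ≠ [] ∧
    (b.map Prod.snd).Nodup ∧ Admissible (b.map Prod.fst) ∧ (IsComb (blockVars b) χ ∨
      ∃ x₀ ∈ φ.fv, IsComb (insert x₀ (blockVars b)) χ)) : IsAUFm φ := by
  obtain ⟨b, χ, rfl, hb, hx, hQ, hχ | ⟨x₀, hx₀, hχ⟩⟩ := h
  · exact IsAUFm.block b χ hb hx hQ hχ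
  · rw [fv_quantify, Finset.mem_sdiff] at hx₀
    exact IsAUFm.blockFree x₀ b χ (List.nodup_cons.2 ⟨by simpa [blockVars] using hx₀.2, hx⟩) hQ
      (by rwa [List.toFinset_cons])

theorem isAUFm_iff_shape {φ : Formula} : IsAUFm φ ↔ Shape φ := by
  refine ⟨IsAUFm.shape, fun h => ?_⟩
  cases φ with
  | atom R args => exact IsAUFm.atom R args h
  | natom R args => exact IsAUFm.natom R args h
  | and φ ψ => exact IsAUFm.and h.1 h.2
  | or φ ψ => exact IsAUFm.or h.1 h.2
  | all x φ => exact isAUFm_of_block h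
  | ex x φ => exact isAUFm_of_block h

end Inversion

namespace Formula

/-- The free variables as a list. -/
def fvList : Formula → List ℕ
  | atom _ args => args
  | natom _ args => args
  | and φ ψ => φ.fvList ++ ψ.fvList
  | or φ ψ => φ.fvList ++ ψ.fvList
  | all x φ => φ.fvList.filter (· ≠ x)
  | ex x φ => φ.fvList.filter (· ≠ x)

/-- The maximal subformulas that are not conjunctions or disjunctions. -/
def leaves : Formula → List Formula
  | and φ ψ => φ.leaves ++ ψ.leaves
  | or φ ψ => φ.leaves ++ ψ.leaves
  | φ => [φ]

/-- The ways to write a formula as a block of quantifiers with distinct variables followed by a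
formula. -/
def splits : Formula → List (List (Quantifier × ℕ) × Formula)
  | all x φ => ([], all x φ) ::
      (φ.splits.filter fun p => x ∉ p.1.map Prod.snd).map fun p => ((Quantifier.all, x) :: p.1, p.2)
  | ex x φ => ([], ex x φ) ::
      (φ.splits.filter fun p => x ∉ p.1.map Prod.snd).map fun p => ((Quantifier.ex, x) :: p.1, p.2)
  | φ => [([], φ)]

/-- An atom or a negated atom, recognized by its code. -/
def IsLiteral (φ : Formula) : Prop := φ.toNat % 6 ≤ 1

theorem toFinset_fvList (φ : Formula) : φ.fvList.toFinset = φ.fv := by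
  induction φ with
  | atom R args => rfl
  | natom R args => rfl
  | and φ ψ hφ hψ => simp [fvList, fv, hφ, hψ]
  | or φ ψ hφ hψ => simp [fvList, fv, hφ, hψ]
  | all x φ hφ =>
    ext y
    simp [fvList, fv, ← hφ, and_comm]
  | ex x φ hφ =>
    ext y
    simp [fvList, fv, ← hφ, and_comm]

theorem mem_singleton_nil_iff {φ : Formula} (hφ : ∀ x ψ, φ ≠ all x ψ ∧ φ ≠ ex x ψ)
    {b : List (Quantifier × ℕ)} {χ : Formula} :
    (b, χ) ∈ [(([] : List (Quantifier × ℕ)), φ)] ↔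
      φ = quantify b χ ∧ (b.map Prod.snd).Nodup := by
  rcases eq_or_ne b [] with rfl | hb
  · simp [quantify, eq_comm]
  · simp only [List.mem_singleton, Prod.mk.injEq, hb, false_and, false_iff]
    rintro ⟨rfl, -⟩
    obtain ⟨x, ψ, h | h⟩ := quantify_eq_of_ne_nil hb χ
    · exact (hφ x ψ).1 h
    · exact (hφ x ψ).2 h

theorem mem_splits {φ : Formula} {b : List (Quantifier × ℕ)} {χ : Formula} :
    (b, χ) ∈ φ.splits ↔ φ = quantify b χ ∧ (b.map Prod.snd).Nodup := by
  induction φ generalizing b χ with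
  | atom R args => exact mem_singleton_nil_iff (by simp)
  | natom R args => exact mem_singleton_nil_iff (by simp)
  | and φ ψ hφ hψ => exact mem_singleton_nil_iff (by simp)
  | or φ ψ hφ hψ => exact mem_singleton_nil_iff (by simp)
  | all x φ ih =>
    rcases b with _ | ⟨⟨q, y⟩, b⟩
    · simp [splits, quantify, eq_comm (a := χ)]
    · cases q
      · simp only [splits, List.mem_cons, Prod.mk.injEq, List.cons_ne_nil, false_and, false_or,
          List.mem_map, List.mem_filter, decide_eq_true_eq, quantify, Formula.all.injEq,
          List.map_cons, List.nodup_cons, Prod.exists, ih, List.cons.injEq, true_and]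
        constructor
        · rintro ⟨c, θ, ⟨⟨h1, h2⟩, h3⟩, ⟨rfl, rfl⟩, rfl⟩
          exact ⟨⟨rfl, h1⟩, h3, h2⟩
        · rintro ⟨⟨rfl, h1⟩, h3, h2⟩
          exact ⟨b, χ, ⟨⟨h1, h2⟩, h3⟩, ⟨rfl, rfl⟩, rfl⟩
      · simp [splits, quantify]
  | ex x φ ih =>
    rcases b with _ | ⟨⟨q, y⟩, b⟩
    · simp [splits, quantify, eq_comm (a := χ)]
    · cases q
      · simp [splits, quantify]
      · simp only [splits, List.mem_cons, Prod.mk.injEq, List.cons_ne_nil, false_and, false_or,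
          List.mem_map, List.mem_filter, decide_eq_true_eq, quantify, Formula.ex.injEq,
          List.map_cons, List.nodup_cons, Prod.exists, ih, List.cons.injEq, true_and]
        constructor
        · rintro ⟨c, θ, ⟨⟨h1, h2⟩, h3⟩, ⟨rfl, rfl⟩, rfl⟩
          exact ⟨⟨rfl, h1⟩, h3, h2⟩
        · rintro ⟨⟨rfl, h1⟩, h3, h2⟩
          exact ⟨b, χ, ⟨⟨h1, h2⟩, h3⟩, ⟨rfl, rfl⟩, rfl⟩

theorem isLiteral_atom (R : ℕ) (args : List ℕ) : (atom R args).IsLiteral := by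
  simp only [IsLiteral, Formula.toNat]
  omega

theorem isLiteral_natom (R : ℕ) (args : List ℕ) : (natom R args).IsLiteral := by
  simp only [IsLiteral, Formula.toNat]
  omega

theorem isLiteral_iff {φ : Formula} :
    φ.IsLiteral ↔ (∃ R args, φ = atom R args) ∨ ∃ R args, φ = natom R args := by
  constructor
  · intro h
    cases φ with
    | atom R args => exact Or.inl ⟨R, args, rfl⟩
    | natom R args => exact Or.inr ⟨R, args, rfl⟩
    | _ => simp only [IsLiteral, Formula.toNat] at h; omega
  · rintro (⟨R, args, rfl⟩ | ⟨R, args, rfl⟩)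
    · exact isLiteral_atom R args
    · exact isLiteral_natom R args

theorem toNat_le_of_mem_leaves {φ ψ : Formula} (h : ψ ∈ φ.leaves) : ψ.toNat ≤ φ.toNat := by
  induction φ with
  | and φ₁ φ₂ h1 h2 =>
    have := and_bounds φ₁ φ₂
    rcases List.mem_append.1 h with h | h
    · have := h1 h
      omega
    · have := h2 h
      omega
  | or φ₁ φ₂ h1 h2 =>
    have := or_bounds φ₁ φ₂
    rcases List.mem_append.1 h with h | h
    · have := h1 h
      omega
    · have := h2 h
      omega
  | _ => rw [List.mem_singleton.1 h]

end Formula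

theorem isComb_and_iff {V : Finset ℕ} {φ ψ : Formula} :
    IsComb V (φ.and ψ) ↔ IsComb V φ ∧ IsComb V ψ := by
  refine ⟨fun h => ?_, fun h => .and h.1 h.2⟩
  cases h with
  | mem hφ hV =>
    have := isAUFm_iff_shape.1 hφ
    exact ⟨.mem this.1 (Finset.subset_union_left.trans hV),
      .mem this.2 (Finset.subset_union_right.trans hV)⟩
  | and h1 h2 => exact ⟨h1, h2⟩

theorem isComb_or_iff {V : Finset ℕ} {φ ψ : Formula} :
    IsComb V (φ.or ψ) ↔ IsComb V φ ∧ IsComb V ψ := by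
  refine ⟨fun h => ?_, fun h => .or h.1 h.2⟩
  cases h with
  | mem hφ hV =>
    have := isAUFm_iff_shape.1 hφ
    exact ⟨.mem this.1 (Finset.subset_union_left.trans hV),
      .mem this.2 (Finset.subset_union_right.trans hV)⟩
  | or h1 h2 => exact ⟨h1, h2⟩

/-- Membership of a conjunction or disjunction in `AUF₁⁻` descends to its parts, so it suffices to
look at the leaves. -/
theorem isComb_iff_leaves {V : Finset ℕ} {χ : Formula} :
    IsComb V χ ↔ ∀ ψ ∈ χ.leaves, (ψ.IsLiteral ∧ ψ.fv = V) ∨ (IsAUFm ψ ∧ ψ.fv ⊆ V) := by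
  induction χ with
  | and φ ψ hφ hψ => simp only [isComb_and_iff, hφ, hψ, leaves, List.forall_mem_append]
  | or φ ψ hφ hψ => simp only [isComb_or_iff, hφ, hψ, leaves, List.forall_mem_append]
  | atom R args =>
    simp only [leaves, List.mem_singleton, forall_eq, isLiteral_atom, true_and]
    refine ⟨fun h => ?_, fun h => h.elim (fun h => .atom R args h) fun h => .mem h.1 h.2⟩
    cases h with
    | mem hφ hV => exact Or.inr ⟨hφ, hV⟩
    | atom _ _ h => exact Or.inl h
  | natom R args =>
    simp only [leaves, List.mem_singleton, forall_eq, isLiteral_natom, true_and]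
    refine ⟨fun h => ?_, fun h => h.elim (fun h => .natom R args h) fun h => .mem h.1 h.2⟩
    cases h with
    | mem hφ hV => exact Or.inr ⟨hφ, hV⟩
    | natom _ _ h => exact Or.inl h
  | all x φ =>
    simp only [leaves, List.mem_singleton, forall_eq, isLiteral_iff, reduceCtorEq, exists_false,
      or_self, false_and, false_or]
    refine ⟨fun h => ?_, fun h => .mem h.1 h.2⟩
    cases h with
    | mem hφ hV => exact ⟨hφ, hV⟩
  | ex x φ =>
    simp only [leaves, List.mem_singleton, forall_eq, isLiteral_iff, reduceCtorEq, exists_false,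
      or_self, false_and, false_or]
    refine ⟨fun h => ?_, fun h => .mem h.1 h.2⟩
    cases h with
    | mem hφ hV => exact ⟨hφ, hV⟩

/-! ### The recognition algorithm -/

section Recognition

/-- Quantifiers as Boolean values. -/
def Quantifier.equivBool : Quantifier ≃ Bool where
  toFun
    | .all => true
    | .ex => false
  invFun
    | true => .all
    | false => .ex
  left_inv q := by cases q <;> rfl
  right_inv q := by cases q <;> rfl

instance : Primcodable Quantifier := Primcodable.ofEquiv Bool Quantifier.equivBool

theorem primrec_fvList : Primrec fvList := by
  have happ : Primrec₂ fun (_ : Unit) (p : Formula × List ℕ × List ℕ) => p.2.1 ++ p.2.2 :=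
    Primrec.list_append.comp (Primrec.fst.comp (Primrec.snd.comp Primrec.snd))
      (Primrec.snd.comp (Primrec.snd.comp Primrec.snd))
  have hargs : Primrec₂ fun (_ : Unit) (p : Formula × ℕ × List ℕ) => p.2.2 :=
    Primrec.snd.comp (Primrec.snd.comp Primrec.snd)
  have hfil : Primrec₂ fun (_ : Unit) (p : Formula × ℕ × List ℕ) =>
      p.2.2.filter (· ≠ p.2.1) :=
    primrec_filter (R := fun (p : Unit × Formula × ℕ × List ℕ) y => y ≠ p.2.2.1) hargs
      (Primrec.eq.comp Primrec.snd (Primrec.fst.comp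
        (Primrec.snd.comp (Primrec.snd.comp Primrec.fst)))).not
  have h : Primrec₂ fun (_ : Unit) φ => fvList φ :=
    primrec_of_formula_rec hargs hargs happ happ hfil hfil (fun _ _ _ => rfl) (fun _ _ _ => rfl)
      (fun _ _ _ => rfl) (fun _ _ _ => rfl) (fun _ _ _ => rfl) (fun _ _ _ => rfl)
  exact h.comp (Primrec.const ()) Primrec.id

theorem primrec_leaves : Primrec leaves := by
  have happ : Primrec₂ fun (_ : Unit) (p : Formula × List Formula × List Formula) =>
      p.2.1 ++ p.2.2 :=
    Primrec.list_append.comp (Primrec.fst.comp (Primrec.snd.comp Primrec.snd))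
      (Primrec.snd.comp (Primrec.snd.comp Primrec.snd))
  have hself : ∀ {β : Type} [Primcodable β],
      Primrec₂ fun (_ : Unit) (p : Formula × β) => [p.1] :=
    Primrec.list_cons.comp (Primrec.fst.comp Primrec.snd) (Primrec.const [])
  have h : Primrec₂ fun (_ : Unit) φ => leaves φ :=
    primrec_of_formula_rec hself hself happ happ hself hself (fun _ _ _ => rfl) (fun _ _ _ => rfl)
      (fun _ _ _ => rfl) (fun _ _ _ => rfl) (fun _ _ _ => rfl) (fun _ _ _ => rfl)
  exact h.comp (Primrec.const ()) Primrec.id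

theorem primrec_splits : Primrec splits := by
  have hself : ∀ {β : Type} [Primcodable β],
      Primrec₂ fun (_ : Unit) (p : Formula × β) => [(([] : List (Quantifier × ℕ)), p.1)] :=
    Primrec.list_cons.comp ((Primrec.const []).pair (Primrec.fst.comp Primrec.snd))
      (Primrec.const [])
  have hquant : ∀ q : Quantifier, Primrec₂ fun (_ : Unit)
      (p : Formula × ℕ × List (List (Quantifier × ℕ) × Formula)) =>
      (([] : List (Quantifier × ℕ)), p.1) ::
        (p.2.2.filter fun s => p.2.1 ∉ s.1.map Prod.snd).map fun s => ((q, p.2.1) :: s.1, s.2) := by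
    intro q
    have hx : Primrec fun p : Unit × Formula × ℕ × List (List (Quantifier × ℕ) × Formula) =>
        p.2.2.1 := Primrec.fst.comp (Primrec.snd.comp Primrec.snd)
    have hs : Primrec fun p : Unit × Formula × ℕ × List (List (Quantifier × ℕ) × Formula) =>
        p.2.2.2 := Primrec.snd.comp (Primrec.snd.comp Primrec.snd)
    refine Primrec.list_cons.comp ((Primrec.const []).pair (Primrec.fst.comp Primrec.snd))
      (Primrec.list_map (primrec_filter
        (R := fun (p : Unit × Formula × ℕ × List (List (Quantifier × ℕ) × Formula)) s =>
          p.2.2.1 ∉ s.1.map Prod.snd) hs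
        (primrecPred_mem (hx.comp Primrec.fst) (Primrec.list_map
          (Primrec.fst.comp Primrec.snd) (Primrec.snd.comp Primrec.snd).to₂)).not) ?_)
    exact (Primrec.list_cons.comp ((Primrec.const q).pair (hx.comp Primrec.fst))
      (Primrec.fst.comp Primrec.snd)).pair (Primrec.snd.comp Primrec.snd)
  have h : Primrec₂ fun (_ : Unit) φ => splits φ :=
    primrec_of_formula_rec hself hself hself hself (hquant .all) (hquant .ex) (fun _ _ _ => rfl)
      (fun _ _ _ => rfl) (fun _ _ _ => rfl) (fun _ _ _ => rfl) (fun _ _ _ => rfl)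
      (fun _ _ _ => rfl)
  exact h.comp (Primrec.const ()) Primrec.id

theorem primrecPred_isLiteral : PrimrecPred IsLiteral :=
  Primrec.nat_le.comp (Primrec.nat_mod.comp primrec_toNat (Primrec.const 6)) (Primrec.const 1)

theorem primrecPred_admissible : PrimrecPred Admissible := by
  classical
  have h1 : PrimrecPred fun Q : List Quantifier => ∀ q ∈ Q, q = Quantifier.all :=
    primrecPred_forall_mem (R := fun _ q => q = Quantifier.all) Primrec.id
      (Primrec.eq.comp Primrec.snd (Primrec.const _))
  have h2 : PrimrecPred fun Q : List Quantifier => Q.reverse.head? = some Quantifier.ex :=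
    Primrec.eq.comp (Primrec.list_head?.comp Primrec.list_reverse) (Primrec.const _)
  exact (h1.or h2).of_eq fun Q => by rw [Admissible, List.head?_reverse]

/-- The condition for membership in `AUF₁⁻` of the formula whose code is the length of `l`, where
`l` lists the answers for all smaller codes. -/
def RecognitionStep (l : List Bool) : Prop :=
  ((ofNat l.length).IsLiteral ∧
    ∀ x ∈ (ofNat l.length).fvList, ∀ y ∈ (ofNat l.length).fvList, x = y) ∨
  (l.length % 6 = 2 ∨ l.length % 6 = 3) ∧
    l[(l.length / 6).unpair.1]? = some true ∧ l[(l.length / 6).unpair.2]? = some true ∨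
  ∃ s ∈ (ofNat l.length).splits, s.1 ≠ [] ∧ Admissible (s.1.map Prod.fst) ∧
    ∃ P ∈ [] :: (ofNat l.length).fvList.map fun x => [x], ∀ ψ ∈ s.2.leaves,
      (ψ.IsLiteral ∧ ψ.fvList ⊆ P ++ s.1.map Prod.snd ∧ P ++ s.1.map Prod.snd ⊆ ψ.fvList) ∨
      (l[ψ.toNat]? = some true ∧ ψ.fvList ⊆ P ++ s.1.map Prod.snd)

theorem primrecPred_recognitionStep : PrimrecPred RecognitionStep := by
  have hφ : Primrec fun l : List Bool => ofNat l.length := primrec_ofNat.comp Primrec.list_length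
  have hfv := primrec_fvList.comp hφ
  have hd : Primrec fun l : List Bool => (l.length / 6).unpair :=
    Primrec.unpair.comp (Primrec.nat_div.comp Primrec.list_length (Primrec.const 6))
  have hmod : ∀ k, PrimrecPred fun l : List Bool => l.length % 6 = k := fun k =>
    Primrec.eq.comp (Primrec.nat_mod.comp Primrec.list_length (Primrec.const 6)) (Primrec.const k)
  refine PrimrecPred.or ?_ (PrimrecPred.or ?_ ?_)
  · refine (primrecPred_isLiteral.comp hφ).and (primrecPred_forall_mem hfv ?_)
    exact primrecPred_forall_mem (R := fun (p : List Bool × ℕ) y => p.2 = y)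
      (hfv.comp Primrec.fst) (Primrec.eq.comp (Primrec.snd.comp Primrec.fst) Primrec.snd)
  · exact ((hmod 2).or (hmod 3)).and
      ((Primrec.eq.comp (Primrec.list_getElem?.comp Primrec.id (Primrec.fst.comp hd))
        (Primrec.const _)).and
      (Primrec.eq.comp (Primrec.list_getElem?.comp Primrec.id (Primrec.snd.comp hd))
        (Primrec.const _)))
  · refine primrecPred_exists_mem (primrec_splits.comp hφ) ?_
    have hb : Primrec fun p : List Bool × List (Quantifier × ℕ) × Formula => p.2.1 :=
      Primrec.fst.comp Primrec.snd
    refine (Primrec.eq.comp hb (Primrec.const [])).not.and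
      ((primrecPred_admissible.comp (Primrec.list_map hb (Primrec.fst.comp Primrec.snd).to₂)).and
        ?_)
    refine primrecPred_exists_mem (α := List Bool × List (Quantifier × ℕ) × Formula)
      (R := fun p P => ∀ ψ ∈ p.2.2.leaves,
        (ψ.IsLiteral ∧ ψ.fvList ⊆ P ++ p.2.1.map Prod.snd ∧ P ++ p.2.1.map Prod.snd ⊆ ψ.fvList) ∨
        (p.1[ψ.toNat]? = some true ∧ ψ.fvList ⊆ P ++ p.2.1.map Prod.snd))
      (Primrec.list_cons.comp (Primrec.const []) (Primrec.list_map (hfv.comp Primrec.fst)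
        (Primrec.list_cons.comp Primrec.snd (Primrec.const [])).to₂)) ?_
    refine primrecPred_forall_mem
      (α := (List Bool × List (Quantifier × ℕ) × Formula) × List ℕ)
      (R := fun p ψ =>
        (ψ.IsLiteral ∧ ψ.fvList ⊆ p.2 ++ p.1.2.1.map Prod.snd ∧
          p.2 ++ p.1.2.1.map Prod.snd ⊆ ψ.fvList) ∨
        (p.1.1[ψ.toNat]? = some true ∧ ψ.fvList ⊆ p.2 ++ p.1.2.1.map Prod.snd))
      (primrec_leaves.comp (Primrec.snd.comp (Primrec.snd.comp Primrec.fst))) ?_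
    have hV : Primrec fun p : ((List Bool × List (Quantifier × ℕ) × Formula) × List ℕ) × Formula =>
        p.1.2 ++ p.1.1.2.1.map Prod.snd :=
      Primrec.list_append.comp (Primrec.snd.comp Primrec.fst)
        (Primrec.list_map (hb.comp (Primrec.fst.comp Primrec.fst))
          (Primrec.snd.comp Primrec.snd).to₂)
    have hψ : Primrec fun p : ((List Bool × List (Quantifier × ℕ) × Formula) × List ℕ) × Formula =>
        p.2.fvList := primrec_fvList.comp Primrec.snd
    refine ((primrecPred_isLiteral.comp Primrec.snd).and
      ((primrecPred_subset hψ hV).and (primrecPred_subset hV hψ))).or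
        (PrimrecPred.and ?_ (primrecPred_subset hψ hV))
    exact Primrec.eq.comp (Primrec.list_getElem?.comp
      (Primrec.fst.comp (Primrec.fst.comp Primrec.fst)) (primrec_toNat.comp Primrec.snd))
      (Primrec.const _)

theorem isComb_toFinset_iff {V : List ℕ} {χ : Formula} :
    IsComb V.toFinset χ ↔ ∀ ψ ∈ χ.leaves, (ψ.IsLiteral ∧ ψ.fvList ⊆ V ∧ V ⊆ ψ.fvList) ∨
      (IsAUFm ψ ∧ ψ.fvList ⊆ V) := by
  have hsub : ∀ l l' : List ℕ, l.toFinset ⊆ l'.toFinset ↔ l ⊆ l' := fun l l' => by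
    simp [Finset.subset_iff, List.subset_def]
  simp only [isComb_iff_leaves, ← toFinset_fvList, Finset.Subset.antisymm_iff, hsub]

open Classical in
/-- The recognition step gives the right answer when `l` does. The leaves of a split have smaller codes
than the formula, because the block is not empty; so their answers are on the list. -/
theorem recognitionStep_iff (φ : Formula) :
    RecognitionStep ((List.range φ.toNat).map fun n => decide (IsAUFm (ofNat n))) ↔
      IsAUFm φ := by
  set l := (List.range φ.toNat).map fun n => decide (IsAUFm (ofNat n)) with hl
  have hlen : l.length = φ.toNat := by simp [hl]
  have look : ∀ ψ : Formula, ψ.toNat < φ.toNat → (l[ψ.toNat]? = some true ↔ IsAUFm ψ) :=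
    fun ψ h => by rw [hl, getElem?_map_range _ h, ofNat_toNat]; simp
  have hone : (∀ x ∈ φ.fvList, ∀ y ∈ φ.fvList, x = y) ↔ φ.fv.card ≤ 1 := by
    rw [Finset.card_le_one, ← toFinset_fvList]
    simp
  have hblock : (∃ s ∈ φ.splits, s.1 ≠ [] ∧ Admissible (s.1.map Prod.fst) ∧
      ∃ P ∈ [] :: φ.fvList.map fun x => [x], ∀ ψ ∈ s.2.leaves,
        (ψ.IsLiteral ∧ ψ.fvList ⊆ P ++ s.1.map Prod.snd ∧ P ++ s.1.map Prod.snd ⊆ ψ.fvList) ∨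
        (l[ψ.toNat]? = some true ∧ ψ.fvList ⊆ P ++ s.1.map Prod.snd)) ↔
      ∃ b χ, φ = quantify b χ ∧ b ≠ [] ∧ (b.map Prod.snd).Nodup ∧ Admissible (b.map Prod.fst) ∧
        (IsComb (blockVars b) χ ∨ ∃ x₀ ∈ φ.fv, IsComb (insert x₀ (blockVars b)) χ) := by
    rw [Prod.exists]
    refine exists_congr fun b => exists_congr fun χ => ?_
    rw [mem_splits]
    have hcomb : φ = quantify b χ → b ≠ [] → ((∃ P ∈ [] :: φ.fvList.map fun x => [x],
        ∀ ψ ∈ χ.leaves,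
          (ψ.IsLiteral ∧ ψ.fvList ⊆ P ++ b.map Prod.snd ∧ P ++ b.map Prod.snd ⊆ ψ.fvList) ∨
          (l[ψ.toNat]? = some true ∧ ψ.fvList ⊆ P ++ b.map Prod.snd)) ↔
        (IsComb (blockVars b) χ ∨ ∃ x₀ ∈ φ.fv, IsComb (insert x₀ (blockVars b)) χ)) := by
      intro h hb
      have hle := toNat_add_length_le b χ
      rw [← h] at hle
      have hpos := List.length_pos_iff.2 hb
      have hl' : ∀ ψ ∈ χ.leaves, (l[ψ.toNat]? = some true ↔ IsAUFm ψ) := fun ψ hψ =>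
        look ψ (by
          have := toNat_le_of_mem_leaves hψ
          omega)
      have hP : ∀ P : List ℕ, (∀ ψ ∈ χ.leaves,
          (ψ.IsLiteral ∧ ψ.fvList ⊆ P ++ b.map Prod.snd ∧ P ++ b.map Prod.snd ⊆ ψ.fvList) ∨
          (l[ψ.toNat]? = some true ∧ ψ.fvList ⊆ P ++ b.map Prod.snd)) ↔
          IsComb (P ++ b.map Prod.snd).toFinset χ := fun P => by
        rw [isComb_toFinset_iff]
        exact forall₂_congr fun ψ hψ => by rw [hl' ψ hψ]
      simp only [hP, List.exists_mem_cons_iff, List.nil_append, ← toFinset_fvList φ,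
        List.mem_toFinset]
      simp [blockVars]
    constructor
    · rintro ⟨⟨h, hx⟩, hb, hQ, hP⟩
      exact ⟨h, hb, hx, hQ, (hcomb h hb).1 hP⟩
    · rintro ⟨h, hb, hx, hQ, hP⟩
      exact ⟨⟨h, hx⟩, hb, hQ, (hcomb h hb).2 hP⟩
  have hdef : RecognitionStep l ↔ (φ.IsLiteral ∧ φ.fv.card ≤ 1) ∨
      (φ.toNat % 6 = 2 ∨ φ.toNat % 6 = 3) ∧ l[(φ.toNat / 6).unpair.1]? = some true ∧
        l[(φ.toNat / 6).unpair.2]? = some true ∨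
      ∃ b χ, φ = quantify b χ ∧ b ≠ [] ∧ (b.map Prod.snd).Nodup ∧ Admissible (b.map Prod.fst) ∧
        (IsComb (blockVars b) χ ∨ ∃ x₀ ∈ φ.fv, IsComb (insert x₀ (blockVars b)) χ) := by
    simp only [RecognitionStep, hlen, ofNat_toNat, hone, hblock]
  rw [hdef]
  constructor
  · rintro (⟨h, hc⟩ | ⟨h6, h1, h2⟩ | h)
    · obtain ⟨R, args, rfl⟩ | ⟨R, args, rfl⟩ := isLiteral_iff.1 h
      · exact .atom R args hc
      · exact .natom R args hc
    · cases φ with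
      | and φ ψ =>
        have hd : (φ.and ψ).toNat / 6 = Nat.pair φ.toNat ψ.toNat := by
          simp only [Formula.toNat]; omega
        have hb := and_bounds φ ψ
        rw [hd, Nat.unpair_pair] at h1 h2
        exact .and ((look φ hb.1).1 h1) ((look ψ hb.2).1 h2)
      | or φ ψ =>
        have hd : (φ.or ψ).toNat / 6 = Nat.pair φ.toNat ψ.toNat := by
          simp only [Formula.toNat]; omega
        have hb := or_bounds φ ψ
        rw [hd, Nat.unpair_pair] at h1 h2
        exact .or ((look φ hb.1).1 h1) ((look ψ hb.2).1 h2)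
      | _ => simp only [Formula.toNat] at h6; omega
    · exact isAUFm_of_block h
  · intro h
    have h := h.shape
    cases φ with
    | atom R args => exact Or.inl ⟨isLiteral_atom R args, h⟩
    | natom R args => exact Or.inl ⟨isLiteral_natom R args, h⟩
    | and φ ψ =>
      have hd : (φ.and ψ).toNat / 6 = Nat.pair φ.toNat ψ.toNat := by
        simp only [Formula.toNat]; omega
      have h6 : (φ.and ψ).toNat % 6 = 2 := by simp only [Formula.toNat]; omega
      have hb := and_bounds φ ψ
      rw [hd, Nat.unpair_pair]
      exact Or.inr (Or.inl ⟨Or.inl h6, (look φ hb.1).2 h.1, (look ψ hb.2).2 h.2⟩)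
    | or φ ψ =>
      have hd : (φ.or ψ).toNat / 6 = Nat.pair φ.toNat ψ.toNat := by
        simp only [Formula.toNat]; omega
      have h6 : (φ.or ψ).toNat % 6 = 3 := by simp only [Formula.toNat]; omega
      have hb := or_bounds φ ψ
      rw [hd, Nat.unpair_pair]
      exact Or.inr (Or.inl ⟨Or.inr h6, (look φ hb.1).2 h.1, (look ψ hb.2).2 h.2⟩)
    | all x φ => exact Or.inr (Or.inr h)
    | ex x φ => exact Or.inr (Or.inr h)

/-- Membership in `AUF₁⁻` is primitive recursive. -/
theorem primrecPred_isAUFm : PrimrecPred IsAUFm := by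
  classical
  have h : Primrec₂ fun (_ : Unit) n => decide (IsAUFm (ofNat n)) := by
    refine Primrec.nat_strong_rec _ (g := fun _ l => some (decide (RecognitionStep l)))
      (Primrec.option_some.comp ((primrecPred_recognitionStep.decide).comp Primrec.snd))
      fun _ n => ?_
    have := recognitionStep_iff (ofNat n)
    rw [toNat_ofNat] at this
    simp only [this]
  exact ((h.comp (Primrec.const ()) primrec_toNat).primrecPred).of_eq fun φ => by
    rw [ofNat_toNat]

end Recognition

/-! ### The search for a model of given size -/

/-- A structure on the numbers below some bound, as the list of all facts `R(a₁, …, aₖ)` that are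
true in it. -/
abbrev Facts : Type := List (ℕ × List ℕ)

/-- The lists of length `k` of numbers below `B`. -/
def strings (B : ℕ) : ℕ → List (List ℕ)
  | 0 => [[]]
  | k + 1 => (strings B k).flatMap fun s => (List.range B).map fun a => a :: s

theorem mem_strings {B k : ℕ} {s : List ℕ} :
    s ∈ strings B k ↔ s.length = k ∧ ∀ a ∈ s, a < B := by
  induction k generalizing s with
  | zero =>
    simp only [strings, List.mem_singleton, List.length_eq_zero_iff]
    exact ⟨fun h => ⟨h, by simp [h]⟩, fun h => h.1⟩
  | succ k ih =>
    cases s with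
    | nil => simp [strings]
    | cons a s =>
      simp only [strings, List.mem_flatMap, ih, List.mem_map, List.mem_range, List.cons.injEq,
        List.length_cons, Nat.add_right_cancel_iff, List.forall_mem_cons]
      constructor
      · rintro ⟨s, ⟨h1, h2⟩, a, ha, rfl, rfl⟩
        exact ⟨h1, ha, h2⟩
      · rintro ⟨h1, ha, h2⟩
        exact ⟨s, ⟨h1, h2⟩, a, ha, rfl, rfl⟩

theorem primrec_strings : Primrec₂ strings := by
  have h : Primrec₂ fun (B k : ℕ) => Nat.rec (motive := fun _ => List (List ℕ)) [[]]
      (fun _ r => r.flatMap fun s => (List.range B).map fun a => a :: s) k := by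
    refine Primrec.nat_rec (Primrec.const _) (g := fun B (p : ℕ × List (List ℕ)) =>
      p.2.flatMap fun s => (List.range B).map fun a => a :: s) ?_
    refine Primrec.list_flatMap (Primrec.snd.comp Primrec.snd) ?_
    refine Primrec.list_map (Primrec.list_range.comp (Primrec.fst.comp Primrec.fst)) ?_
    exact Primrec.list_cons.comp Primrec.snd (Primrec.snd.comp Primrec.fst)
  refine h.of_eq fun B k => ?_
  induction k with
  | zero => rfl
  | succ k ih => rw [strings, ← ih]

/-- All facts over the numbers below `B` with relation symbol and arity at most `n`. -/
def allFacts (n B : ℕ) : Facts :=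
  (List.range (n + 1)).flatMap fun R => (List.range (n + 1)).flatMap fun k =>
    (strings B k).map fun s => (R, s)

theorem mem_allFacts {n B R : ℕ} {s : List ℕ} :
    (R, s) ∈ allFacts n B ↔ R ≤ n ∧ s.length ≤ n ∧ ∀ a ∈ s, a < B := by
  simp only [allFacts, List.mem_flatMap, List.mem_range, List.mem_map, mem_strings, Prod.mk.injEq]
  constructor
  · rintro ⟨R, hR, k, hk, s, ⟨rfl, h⟩, rfl, rfl⟩
    exact ⟨by omega, by omega, h⟩
  · rintro ⟨hR, hk, h⟩
    exact ⟨R, by omega, s.length, by omega, s, ⟨rfl, h⟩, rfl, rfl⟩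

theorem primrec_allFacts : Primrec₂ allFacts := by
  have hr : Primrec fun p : ℕ × ℕ => List.range (p.1 + 1) :=
    Primrec.list_range.comp (Primrec.succ.comp Primrec.fst)
  refine Primrec.list_flatMap hr (Primrec.list_flatMap (hr.comp Primrec.fst) ?_)
  refine Primrec.list_map (primrec_strings.comp
    (Primrec.snd.comp (Primrec.fst.comp Primrec.fst)) Primrec.snd) ?_
  exact (Primrec.snd.comp (Primrec.fst.comp Primrec.fst)).pair Primrec.snd

/-- The sublists of a list. -/
def sublistsOf (l : Facts) : List Facts :=
  l.foldr (fun a r => r ++ r.map fun s => a :: s) [[]]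

theorem filter_mem_sublistsOf (p : ℕ × List ℕ → Bool) (l : Facts) :
    l.filter p ∈ sublistsOf l := by
  induction l with
  | nil => simp [sublistsOf]
  | cons a l ih =>
    have : sublistsOf (a :: l) = sublistsOf l ++ (sublistsOf l).map fun s => a :: s := rfl
    rw [this, List.mem_append, List.mem_map, List.filter_cons]
    split_ifs
    · exact Or.inr ⟨_, ih, rfl⟩
    · exact Or.inl ih

theorem primrec_sublistsOf : Primrec sublistsOf := by
  refine Primrec.list_foldr (α := Facts) Primrec.id (Primrec.const [[]])
    (h := fun _ (p : (ℕ × List ℕ) × List Facts) => p.2 ++ p.2.map fun s => p.1 :: s) ?_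
  have h2 : Primrec fun p : Facts × (ℕ × List ℕ) × List Facts => p.2.2 :=
    Primrec.snd.comp Primrec.snd
  refine Primrec.list_append.comp h2 (Primrec.list_map h2 ?_)
  exact Primrec.list_cons.comp (Primrec.fst.comp (Primrec.snd.comp Primrec.fst)) Primrec.snd

/-- Satisfaction in a structure on the numbers below `B`, with the list `s` as the assignment. -/
def Formula.EvalList (M : Facts) (B : ℕ) : Formula → List ℕ → Prop
  | atom R args, s => (R, args.map fun x => s.getD x 0) ∈ M
  | natom R args, s => (R, args.map fun x => s.getD x 0) ∉ M
  | and φ ψ, s => φ.EvalList M B s ∧ ψ.EvalList M B s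
  | or φ ψ, s => φ.EvalList M B s ∨ ψ.EvalList M B s
  | all x φ, s => ∀ a < B, φ.EvalList M B (s.set x a)
  | ex x φ, s => ∃ a < B, φ.EvalList M B (s.set x a)

open Classical in
/-- The list of all satisfying assignments of length `k`. -/
noncomputable def satList (c : Facts × ℕ × ℕ) (φ : Formula) : List (List ℕ) :=
  (strings c.2.1 c.2.2).filter fun s => φ.EvalList c.1 c.2.1 s

theorem mem_satList {c : Facts × ℕ × ℕ} {φ : Formula} {s : List ℕ} :
    s ∈ satList c φ ↔ s ∈ strings c.2.1 c.2.2 ∧ φ.EvalList c.1 c.2.1 s := by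
  classical
  simp [satList]

theorem set_mem_strings {B k : ℕ} {s : List ℕ} (hs : s ∈ strings B k) {x a : ℕ} (ha : a < B) :
    s.set x a ∈ strings B k := by
  rw [mem_strings] at hs ⊢
  refine ⟨by simpa using hs.1, fun b hb => ?_⟩
  rcases List.mem_or_eq_of_mem_set hb with hb | rfl
  · exact hs.2 b hb
  · exact ha

theorem primrec_strings_fst {β : Type} [Primcodable β] :
    Primrec fun p : (Facts × ℕ × ℕ) × β => strings p.1.2.1 p.1.2.2 :=
  primrec_strings.comp (Primrec.fst.comp (Primrec.snd.comp Primrec.fst))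
    (Primrec.snd.comp (Primrec.snd.comp Primrec.fst))

section SatListSteps

open Classical

theorem primrec_satList_atom :
    (Primrec₂ fun (c : Facts × ℕ × ℕ) (p : Formula × ℕ × List ℕ) =>
      (strings c.2.1 c.2.2).filter fun s => (p.2.1, p.2.2.map fun x => s.getD x 0) ∈ c.1) ∧
    Primrec₂ fun (c : Facts × ℕ × ℕ) (p : Formula × ℕ × List ℕ) =>
      (strings c.2.1 c.2.2).filter fun s => (p.2.1, p.2.2.map fun x => s.getD x 0) ∉ c.1 := by
  have h1 : Primrec fun q : ((Facts × ℕ × ℕ) × Formula × ℕ × List ℕ) × List ℕ => q.1.2.2 :=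
    Primrec.snd.comp (Primrec.snd.comp Primrec.fst)
  have hval : Primrec fun q : ((Facts × ℕ × ℕ) × Formula × ℕ × List ℕ) × List ℕ =>
      (q.1.2.2.1, q.1.2.2.2.map fun x => q.2.getD x 0) :=
    (Primrec.fst.comp h1).pair (Primrec.list_map (Primrec.snd.comp h1)
      ((Primrec.list_getD 0).comp (Primrec.snd.comp Primrec.fst) Primrec.snd).to₂)
  have hat : PrimrecPred fun q : ((Facts × ℕ × ℕ) × Formula × ℕ × List ℕ) × List ℕ =>
      (q.1.2.2.1, q.1.2.2.2.map fun x => q.2.getD x 0) ∈ q.1.1.1 :=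
    primrecPred_mem hval (Primrec.fst.comp (Primrec.fst.comp Primrec.fst))
  exact ⟨primrec_filter (R := fun (p : (Facts × ℕ × ℕ) × Formula × ℕ × List ℕ) (s : List ℕ) =>
      (p.2.2.1, p.2.2.2.map fun x => s.getD x 0) ∈ p.1.1) primrec_strings_fst hat,
    primrec_filter (R := fun (p : (Facts × ℕ × ℕ) × Formula × ℕ × List ℕ) (s : List ℕ) =>
      (p.2.2.1, p.2.2.2.map fun x => s.getD x 0) ∉ p.1.1) primrec_strings_fst hat.not⟩

theorem primrec_satList_binary :
    (Primrec₂ fun (c : Facts × ℕ × ℕ) (p : Formula × List (List ℕ) × List (List ℕ)) =>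
      (strings c.2.1 c.2.2).filter fun s => s ∈ p.2.1 ∧ s ∈ p.2.2) ∧
    Primrec₂ fun (c : Facts × ℕ × ℕ) (p : Formula × List (List ℕ) × List (List ℕ)) =>
      (strings c.2.1 c.2.2).filter fun s => s ∈ p.2.1 ∨ s ∈ p.2.2 := by
  have h : Primrec fun q : ((Facts × ℕ × ℕ) × Formula × List (List ℕ) × List (List ℕ)) ×
      List ℕ => q.1.2.2 := Primrec.snd.comp (Primrec.snd.comp Primrec.fst)
  have hm1 : PrimrecPred fun q : ((Facts × ℕ × ℕ) × Formula × List (List ℕ) × List (List ℕ)) ×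
      List ℕ => q.2 ∈ q.1.2.2.1 := primrecPred_mem Primrec.snd (Primrec.fst.comp h)
  have hm2 : PrimrecPred fun q : ((Facts × ℕ × ℕ) × Formula × List (List ℕ) × List (List ℕ)) ×
      List ℕ => q.2 ∈ q.1.2.2.2 := primrecPred_mem Primrec.snd (Primrec.snd.comp h)
  exact ⟨primrec_filter
      (R := fun (p : (Facts × ℕ × ℕ) × Formula × List (List ℕ) × List (List ℕ)) (s : List ℕ) =>
        s ∈ p.2.2.1 ∧ s ∈ p.2.2.2) primrec_strings_fst (hm1.and hm2),
    primrec_filter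
      (R := fun (p : (Facts × ℕ × ℕ) × Formula × List (List ℕ) × List (List ℕ)) (s : List ℕ) =>
        s ∈ p.2.2.1 ∨ s ∈ p.2.2.2) primrec_strings_fst (hm1.or hm2)⟩

theorem primrec_satList_quantifier :
    (Primrec₂ fun (c : Facts × ℕ × ℕ) (p : Formula × ℕ × List (List ℕ)) =>
      (strings c.2.1 c.2.2).filter fun s => ∀ a ∈ List.range c.2.1, s.set p.2.1 a ∈ p.2.2) ∧
    Primrec₂ fun (c : Facts × ℕ × ℕ) (p : Formula × ℕ × List (List ℕ)) =>
      (strings c.2.1 c.2.2).filter fun s => ∃ a ∈ List.range c.2.1, s.set p.2.1 a ∈ p.2.2 := by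
  have h0 : Primrec fun q : (((Facts × ℕ × ℕ) × Formula × ℕ × List (List ℕ)) × List ℕ) × ℕ =>
      q.1.1.2.2 := Primrec.snd.comp (Primrec.snd.comp (Primrec.fst.comp Primrec.fst))
  have h1 : Primrec fun q : (((Facts × ℕ × ℕ) × Formula × ℕ × List (List ℕ)) × List ℕ) × ℕ =>
      q.1.2 := Primrec.snd.comp Primrec.fst
  have h2 : Primrec fun q : (((Facts × ℕ × ℕ) × Formula × ℕ × List (List ℕ)) × List ℕ) × ℕ =>
      (q.1.1.2.2.1, q.2) := (Primrec.fst.comp h0).pair Primrec.snd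
  have h3 := (Primrec.list_set (α := ℕ)).comp h1 h2
  have hset := primrecPred_mem h3 (Primrec.snd.comp h0)
  have hrange : Primrec fun q : ((Facts × ℕ × ℕ) × Formula × ℕ × List (List ℕ)) × List ℕ =>
      List.range q.1.1.2.1 :=
    Primrec.list_range.comp (Primrec.fst.comp (Primrec.snd.comp (Primrec.fst.comp Primrec.fst)))
  have hall := primrecPred_forall_mem
    (R := fun (q : ((Facts × ℕ × ℕ) × Formula × ℕ × List (List ℕ)) × List ℕ) a =>
      q.2.set q.1.2.2.1 a ∈ q.1.2.2.2) hrange hset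
  have hex := primrecPred_exists_mem
    (R := fun (q : ((Facts × ℕ × ℕ) × Formula × ℕ × List (List ℕ)) × List ℕ) a =>
      q.2.set q.1.2.2.1 a ∈ q.1.2.2.2) hrange hset
  constructor
  · refine (primrec_filter (α := (Facts × ℕ × ℕ) × Formula × ℕ × List (List ℕ))
      (R := fun p (s : List ℕ) => ∀ a ∈ List.range p.1.2.1, s.set p.2.2.1 a ∈ p.2.2.2)
      primrec_strings_fst hall).of_eq fun p => ?_
    exact List.filter_congr fun s _ => decide_eq_decide.2 Iff.rfl
  · refine (primrec_filter (α := (Facts × ℕ × ℕ) × Formula × ℕ × List (List ℕ))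
      (R := fun p (s : List ℕ) => ∃ a ∈ List.range p.1.2.1, s.set p.2.2.1 a ∈ p.2.2.2)
      primrec_strings_fst hex).of_eq fun p => ?_
    exact List.filter_congr fun s _ => decide_eq_decide.2 Iff.rfl

theorem primrec_satList : Primrec₂ satList := by
  refine primrec_of_formula_rec primrec_satList_atom.1 primrec_satList_atom.2
    primrec_satList_binary.1 primrec_satList_binary.2 primrec_satList_quantifier.1
    primrec_satList_quantifier.2 ?_ ?_ ?_ ?_ ?_ ?_
  · exact fun c R args => List.filter_congr fun s _ => decide_eq_decide.2 Iff.rfl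
  · exact fun c R args => List.filter_congr fun s _ => decide_eq_decide.2 Iff.rfl
  · intro c φ ψ
    refine List.filter_congr fun s hs => decide_eq_decide.2 ?_
    simp only [EvalList, mem_satList, hs, true_and]
  · intro c φ ψ
    refine List.filter_congr fun s hs => decide_eq_decide.2 ?_
    simp only [EvalList, mem_satList, hs, true_and]
  · intro c x φ
    refine List.filter_congr fun s hs => decide_eq_decide.2 ?_
    simp only [EvalList, mem_satList, List.mem_range]
    exact forall₂_congr fun a ha => by simp only [set_mem_strings hs ha, true_and]
  · intro c x φ
    refine List.filter_congr fun s hs => decide_eq_decide.2 ?_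
    simp only [EvalList, mem_satList, List.mem_range]
    exact exists_congr fun a => and_congr_right fun ha => by
      simp only [set_mem_strings hs ha, true_and]

end SatListSteps

theorem getD_set_eq_update {B n : ℕ} {s : List ℕ} (hs : s.length = n + 1) {v : ℕ → Fin B}
    (hv : ∀ x ≤ n, s.getD x 0 = v x) (x : ℕ) (a : Fin B) :
    ∀ y ≤ n, (s.set x a).getD y 0 = Function.update v x a y := by
  intro y hy
  by_cases hxy : y = x
  · subst hxy
    have : y < s.length := by omega
    simp [List.getD_eq_getElem?_getD, this]
  · rw [Function.update_of_ne hxy, ← hv y hy]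
    simp [List.getD_eq_getElem?_getD, List.getElem?_set_ne (Ne.symm hxy)]

/-- Evaluation with lists agrees with satisfaction, in a structure whose atoms are as listed. -/
theorem evalList_iff {M : Facts} {B n : ℕ} [sig.Structure (Fin B)]
    (hM : ∀ (R : ℕ) (args : List ℕ) (v : ℕ → Fin B), R ≤ n → args.length ≤ n →
      ((R, args.map fun x => (v x : ℕ)) ∈ M ↔ (atom R args).Realize v))
    {φ : Formula} (hφ : φ.toNat ≤ n) {s : List ℕ} (hs : s.length = n + 1) {v : ℕ → Fin B}
    (hv : ∀ x ≤ n, s.getD x 0 = v x) : φ.EvalList M B s ↔ φ.Realize v := by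
  have hatom : ∀ (R : ℕ) (args : List ℕ), (atom R args).toNat ≤ n → ∀ (s : List ℕ) (v : ℕ → Fin B),
      (∀ x ≤ n, s.getD x 0 = v x) →
      ((R, args.map fun x => s.getD x 0) ∈ M ↔ (atom R args).Realize v) := by
    intro R args h s v hv
    obtain ⟨h1, h2, h3⟩ := args_bounds R args
    rw [← hM R args v (h1.trans h) (h2.trans h),
      List.map_congr_left fun x hx => hv x ((h3 x hx).trans h)]
  induction φ generalizing s v with
  | atom R args => exact hatom R args hφ s v hv
  | natom R args => exact not_congr (hatom R args (by rw [natom_toNat] at hφ; omega) s v hv)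
  | and φ ψ h1 h2 =>
    have := and_bounds φ ψ
    exact and_congr (h1 (by omega) hs hv) (h2 (by omega) hs hv)
  | or φ ψ h1 h2 =>
    have := or_bounds φ ψ
    exact or_congr (h1 (by omega) hs hv) (h2 (by omega) hs hv)
  | all x φ ih =>
    have := all_bounds x φ
    have ih : ∀ a : Fin B, φ.EvalList M B (s.set x a) ↔ φ.Realize (Function.update v x a) :=
      fun a => ih (by omega) (by rw [List.length_set, hs]) (getD_set_eq_update hs hv x a)
    exact Fin.forall_iff.symm.trans (forall_congr' ih)
  | ex x φ ih =>
    have := ex_bounds x φ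
    have ih : ∀ a : Fin B, φ.EvalList M B (s.set x a) ↔ φ.Realize (Function.update v x a) :=
      fun a => ih (by omega) (by rw [List.length_set, hs]) (getD_set_eq_update hs hv x a)
    simp only [EvalList, Realize, ← ih, Fin.exists_iff, exists_prop]

/-- The outcome of the search for a model of size `B`, for a formula with code at most `n`. -/
def HasModelOfSize (n B : ℕ) (φ : Formula) : Prop :=
  ∃ M ∈ sublistsOf (allFacts n B), satList (M, B, n + 1) φ ≠ []

/-- Relations and arities beyond the code of the formula do not occur in it, so that finitely many
facts determine whether a structure on the numbers below `B` is a model. -/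
theorem hasModelOfSize_iff {n B : ℕ} {φ : Formula} (hφ : φ.toNat ≤ n) :
    HasModelOfSize n B φ ↔ ∃ _ : sig.Structure (Fin B), ∃ v : ℕ → Fin B, φ.Realize v := by
  classical
  constructor
  · rintro ⟨M, -, hne⟩
    obtain ⟨s, hs⟩ := List.exists_mem_of_ne_nil _ hne
    obtain ⟨hs, he⟩ := mem_satList.1 hs
    obtain ⟨hlen, hlt⟩ := mem_strings.1 hs
    have hval : ∀ x, ∀ _ : x ≤ n, s[x]?.getD 0 < B := fun x hx => by
      rw [List.getElem?_eq_getElem (by simp only at hlen; omega)]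
      exact hlt _ (List.getElem_mem _)
    let _ : sig.Structure (Fin B) :=
      { funMap := fun f => f.elim
        RelMap := fun {k} R ys => (R, List.ofFn fun i => (ys i : ℕ)) ∈ M }
    refine ⟨inferInstance, fun x => if h : x ≤ n then ⟨s[x]?.getD 0, hval x h⟩
      else ⟨s[0]?.getD 0, hval 0 (Nat.zero_le n)⟩, ?_⟩
    refine (evalList_iff (M := M) (n := n) (fun R args v _ _ => ?_) hφ hlen fun x hx => ?_).1 he
    · have : (args.map fun x => (v x : ℕ)) = List.ofFn fun i => (v (args.get i) : ℕ) := by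
        rw [← List.ofFn_get (args.map fun x => (v x : ℕ))]
        simp
      rw [this]
      rfl
    · simp [hx, List.getD_eq_getElem?_getD]
  · rintro ⟨_, v, hv⟩
    let d := v 0
    let M := (allFacts n B).filter fun f =>
      (atom f.1 (List.range f.2.length)).Realize fun i =>
        if h : f.2.getD i 0 < B then (⟨f.2.getD i 0, h⟩ : Fin B) else d
    let s := (List.range (n + 1)).map fun x => (v x : ℕ)
    have hs : s ∈ strings B (n + 1) := by
      refine mem_strings.2 ⟨by simp [s], fun a ha => ?_⟩
      obtain ⟨x, -, rfl⟩ := List.mem_map.1 ha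
      exact (v x).2
    refine ⟨M, filter_mem_sublistsOf _ _, List.ne_nil_of_mem (a := s) (mem_satList.2 ⟨hs, ?_⟩)⟩
    refine (evalList_iff (n := n) (v := v) (fun R args w hR hl => ?_) hφ (by simp [s])
      fun x hx => ?_).2 hv
    · rw [List.mem_filter, mem_allFacts, decide_eq_true_eq]
      have h1 : R ≤ n ∧ (args.map fun x => (w x : ℕ)).length ≤ n ∧
          ∀ a ∈ args.map fun x => (w x : ℕ), a < B := by
        refine ⟨hR, by simpa using hl, fun a ha => ?_⟩
        obtain ⟨x, -, rfl⟩ := List.mem_map.1 ha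
        exact (w x).2
      rw [and_iff_right h1]
      apply realize_atom_congr
      apply List.ext_getElem
      · simp
      · intro i hi _
        have : i < args.length := by simpa using hi
        simp [List.getD_eq_getElem?_getD, this]
    · have : x < n + 1 := by omega
      simp [s, List.getD_eq_getElem?_getD, this]

theorem primrec_pow : Primrec₂ ((· ^ ·) : ℕ → ℕ → ℕ) :=
  Primrec₂.unpaired'.1 Nat.Primrec.pow

theorem primrec_modelSize : Primrec modelSize := by
  have h1 : Primrec fun n : ℕ => n + 1 := Primrec.succ
  have h2 : Primrec fun n : ℕ => n + 2 := Primrec.succ.comp Primrec.succ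
  exact Primrec.nat_mul.comp h2 (Primrec.nat_mul.comp h2 (Primrec.nat_mul.comp
    (primrec_pow.comp (Primrec.const 2) h1)
    (primrec_pow.comp (primrec_pow.comp (Primrec.const 2) (primrec_pow.comp h2 h1)) h1)))

theorem primrecPred_hasModelOfSize :
    PrimrecPred fun φ : Formula => HasModelOfSize φ.toNat (modelSize φ.toNat) φ := by
  have hB : Primrec fun φ : Formula => modelSize φ.toNat := primrec_modelSize.comp primrec_toNat
  refine primrecPred_exists_mem (R := fun (φ : Formula) M =>
      satList (M, modelSize φ.toNat, φ.toNat + 1) φ ≠ [])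
    (primrec_sublistsOf.comp (primrec_allFacts.comp primrec_toNat hB)) ?_
  exact (Primrec.eq.comp (primrec_satList.comp (Primrec.snd.pair ((hB.comp Primrec.fst).pair
    (Primrec.succ.comp (primrec_toNat.comp Primrec.fst)))) Primrec.fst) (Primrec.const [])).not

theorem primrecPred_isSentence : PrimrecPred IsSentence := by
  classical
  refine (Primrec.eq.comp primrec_fvList (Primrec.const [])).of_eq fun φ => ?_
  rw [IsSentence, ← toFinset_fvList, List.toFinset_eq_empty_iff]

end AUF

/-- The satisfiability problem for `AUF₁⁻` is decidable: the set of satisfiable sentences of this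
logic is a computable set of formulas. -/
theorem theorem3 :
    ComputablePred fun φ : AUF.Formula =>
      AUF.IsAUFm φ ∧ φ.IsSentence ∧ AUF.Formula.Satisfiable.{u} φ := by
  obtain ⟨h, hp⟩ := (AUF.primrecPred_isAUFm.and
    (AUF.primrecPred_isSentence.and AUF.primrecPred_hasModelOfSize)).of_eq (q := fun φ =>
      AUF.IsAUFm φ ∧ φ.IsSentence ∧ AUF.Formula.Satisfiable.{u} φ) fun φ =>
      and_congr_right fun hφ => and_congr_right fun hs => by
        rw [AUF.satisfiable_iff_exists_fin hφ hs, AUF.hasModelOfSize_iff le_rfl]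
  exact ⟨h, hp.to_comp⟩
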